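/- Consider the class of equations $$f(x)\,u_t=(D(u)\,u_x)_x+K(u)\,u_x ,\qquad (\ast)$$ where $f$ (on an open interval of $x$) and $D,K$ (on an open interval of $u$) are smooth, $f$ and $D$ vanish nowhere, and $(D_u,K_u)$ is not identically $(0,0)$. Let $W$ be a non-empty connected open subset of the part $f\neq0$, $D\neq0$ of the space $\mathbb R^6$ with coordinates $(t,x,u,f,D,K)$. An equivalence transformation of the class on $W$ is a smooth diffeomorphism $\varphi$ of $W$ onto its image, $(t,x,u,f,D,K)\mapsto(\tilde t,\tilde x,\tilde u,\tilde f,\tilde D,\tilde K)$, such that for every equation $(\ast)$ with coefficients $(f,D,K)$, near every point $(t,x,u)$ over which the graph of $(f(x),D(u),K(u))$ lies in $W$, substituting $f=f(x)$, $D=D(u)$, $K=K(u)$ in $\varphi$ gives a nonsingular point transformation of $(t,x,u)$ that turns this equation into an equation $\tilde f(\tilde x)\tilde u_{\tilde t}=(\tilde D(\tilde u)\tilde u_{\tilde x})_{\tilde x}+\tilde K(\tilde u)\tilde u_{\tilde x}$ of the class whose coefficients are the transformed values $\tilde f,\tilde D,\tilde K$. (The images of $t,x,u$ are allowed to depend on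 $f,D,K$.) The Lie algebra $A^{\rm equiv}$ of the equivalence group on $W$ consists of the smooth vector fields on $W$ whose local flows consist of equivalence transformations. Then: 1. On every such $W$, $$A^{\rm equiv}=\langle \partial_t,\ \partial_x,\ \partial_u,\ t\partial_t+f\partial_f,\ x\partial_x-2f\partial_f-K\partial_K,\ u\partial_u,\ f\partial_f+K\partial_K+D\partial_D\rangle ,$$ the real linear span of the restrictions to $W$ of these seven vector fields. 2. The equivalence transformations on $W$ are exactly the restrictions to $W$ of the elements of the group of transformations of $\mathbb R^6$ generated by the continuous transformations $$\tilde t=te^{\varepsilon_4}+\varepsilon_1,\quad \tilde x=xe^{\varepsilon_5}+\varepsilon_2,\quad \tilde u=ue^{\varepsilon_6}+\varepsilon_3,\quad \tilde f=fe^{\varepsilon_4-2\varepsilon_5+\varepsilon_7},\quad \tilde D=De^{\varepsilon_7},\quad \tilde K=Ke^{-\varepsilon_5+\varepsilon_7}$$ with $\varepsilon_1,\dots,\varepsilon_7\in\mathbb R$, and the four involutions that change the signs of the variables in the sets $\{t,D,K\}$, $\{x,K\}$, $\{u\}$ and $\{f,D,K\}$, respectively. -/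

import Mathlib

open scoped Topology ContDiff

noncomputable section

namespace DiffConv

/-- The space of the independent and dependent variables, with coordinates `(t, x, u)`. -/
abbrev Base : Type := ℝ × ℝ × ℝ

/-- The space of the variables together with the values of the arbitrary elements, with
coordinates `((t, x, u), (f, D, K))`. -/
abbrev Ext : Type := Base × (ℝ × ℝ × ℝ)

/-- The part `f ≠ 0`, `D ≠ 0` of the extended space, where the arbitrary elements take values. -/
def regular : Set Ext := {z | z.2.1 ≠ 0 ∧ z.2.2.1 ≠ 0}

/-- An equation `f(x) u_t = (D(u) u_x)_x + K(u) u_x` of the class: `f` is smooth and nowhere zero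
on an open interval `I`, `D` and `K` are smooth on an open interval `J`, `D` is nowhere zero
there, and `(D_u, K_u)` is not identically `(0, 0)`. -/
structure Equation where
  I : Set ℝ
  J : Set ℝ
  f : ℝ → ℝ
  D : ℝ → ℝ
  K : ℝ → ℝ
  isOpen_I : IsOpen I
  isOpen_J : IsOpen J
  isPreconnected_I : IsPreconnected I
  isPreconnected_J : IsPreconnected J
  smooth_f : ContDiffOn ℝ ∞ f I
  smooth_D : ContDiffOn ℝ ∞ D J
  smooth_K : ContDiffOn ℝ ∞ K J
  f_ne_zero : ∀ x ∈ I, f x ≠ 0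
  D_ne_zero : ∀ u ∈ J, D u ≠ 0
  nonlinear : ∃ u ∈ J, deriv D u ≠ 0 ∨ deriv K u ≠ 0

namespace Equation

/-- The points `(t, x, u)` at which the coefficients of the equation are defined. -/
def dom (θ : Equation) : Set Base := {p | p.2.1 ∈ θ.I ∧ p.2.2 ∈ θ.J}

/-- The graph of the arbitrary elements: `(t, x, u) ↦ ((t, x, u), (f(x), D(u), K(u)))`. -/
def lift (θ : Equation) (p : Base) : Ext := (p, (θ.f p.2.1, θ.D p.2.2, θ.K p.2.2))

/-- The function `v` of `(t, x)` satisfies the differential equation at the point `s = (t, x)`: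
`f(x) v_t = (D(v) v_x)_x + K(v) v_x`. -/
def HoldsAt (θ : Equation) (v : ℝ × ℝ → ℝ) (s : ℝ × ℝ) : Prop :=
  θ.f s.2 * deriv (fun t ↦ v (t, s.2)) s.1 =
    deriv (fun x ↦ θ.D (v (s.1, x)) * deriv (fun y ↦ v (s.1, y)) x) s.2
      + θ.K (v s) * deriv (fun y ↦ v (s.1, y)) s.2

end Equation

/-- The transformation of `(t, x, u)` induced by a transformation `φ` of the extended space when
the arbitrary elements are those of `θ`. It may depend on `θ`, unless `φ` is projectible. -/
def induced (φ : Ext → Ext) (θ : Equation) (p : Base) : Base := (φ (θ.lift p)).1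

/-- At the point `p`, the transformation `φ` maps the equation `θ` to the equation `θ'`:
the induced transformation of `(t, x, u)` is nonsingular at `p`, the values of the arbitrary
elements of `θ` are taken to those of `θ'`, and the change of variables turns the one
differential equation into the other. The last condition says that, for a function `v` whose graph
passes through `p` and a function `v'` whose graph is near the image of `p` the transform of the
graph of `v`, the function `v` satisfies `θ` at `p` if and only if `v'` satisfies `θ'` at the image
of `p` (so the prolongation of the transformation identifies the two equations as sets
of jets). -/
structure MapsEquationAt (φ : Ext → Ext) (θ θ' : Equation) (p : Base) : Prop where
  nonsingular : Function.Bijective (fderiv ℝ (induced φ θ) p)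
  mem_dom : induced φ θ p ∈ θ'.dom
  map_lift : φ (θ.lift p) = θ'.lift (induced φ θ p)
  holds_iff : ∀ v v' : ℝ × ℝ → ℝ,
    v (p.1, p.2.1) = p.2.2 →
    ContDiffAt ℝ ∞ v (p.1, p.2.1) →
    ContDiffAt ℝ ∞ v' ((induced φ θ p).1, (induced φ θ p).2.1) →
    (∀ᶠ s in 𝓝 (p.1, p.2.1),
      v' ((induced φ θ (s.1, s.2, v s)).1, (induced φ θ (s.1, s.2, v s)).2.1) =
        (induced φ θ (s.1, s.2, v s)).2.2) →
    (θ.HoldsAt v (p.1, p.2.1) ↔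
      θ'.HoldsAt v' ((induced φ θ p).1, (induced φ θ p).2.1))

/-- `φ` is, on the open set `W`, an equivalence transformation of the class: a local diffeomorphism
of the space of `(t, x, u, f, D, K)` which maps every equation of the class, near every point
over which the graph of its arbitrary elements lies in `W`, to an equation of the class. -/
structure IsEquivalence (φ : Ext → Ext) (W : Set Ext) : Prop where
  smooth : ContDiffOn ℝ ∞ φ W
  injOn : Set.InjOn φ W
  bijective_fderiv : ∀ z ∈ W, Function.Bijective (fderiv ℝ φ z)
  maps_class : ∀ (θ : Equation) (p : Base), p ∈ θ.dom → θ.lift p ∈ W →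
    ∃ θ' : Equation, ∀ᶠ q in 𝓝 p, MapsEquationAt φ θ θ' q

/-- The smooth vector field `Q` on the open set `W` belongs to the Lie algebra of the equivalence
group: the transformations of its local flow are equivalence transformations. A vector field
`ξ^t ∂_t + ξ^x ∂_x + η ∂_u + π^f ∂_f + π^D ∂_D + π^K ∂_K` is identified with the map
`((ξ^t, ξ^x, η), (π^f, π^D, π^K))`. -/
structure IsInfinitesimalEquivalence (Q : Ext → Ext) (W : Set Ext) : Prop where
  smooth : ContDiffOn ℝ ∞ Q W
  exists_flow : ∀ z₀ ∈ W, ∃ V : Set Ext, IsOpen V ∧ z₀ ∈ V ∧ V ⊆ W ∧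
    ∃ r : ℝ, 0 < r ∧ ∃ Φ : ℝ → Ext → Ext,
      (∀ z ∈ V, Φ 0 z = z) ∧
      (∀ z ∈ V, ∀ ε : ℝ, |ε| < r → Φ ε z ∈ W ∧ HasDerivAt (fun s ↦ Φ s z) (Q (Φ ε z)) ε) ∧
      (∀ ε : ℝ, |ε| < r → IsEquivalence (Φ ε) V)

/-- The vector fields `∂_t`, `∂_x`, `∂_u`, `t ∂_t + f ∂_f`, `x ∂_x - 2 f ∂_f - K ∂_K`, `u ∂_u`,
`f ∂_f + K ∂_K + D ∂_D`. -/
def generator : Fin 7 → Ext → Ext :=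
  ![fun _ ↦ ((1, 0, 0), (0, 0, 0)),
    fun _ ↦ ((0, 1, 0), (0, 0, 0)),
    fun _ ↦ ((0, 0, 1), (0, 0, 0)),
    fun z ↦ ((z.1.1, 0, 0), (z.2.1, 0, 0)),
    fun z ↦ ((0, z.1.2.1, 0), (-2 * z.2.1, 0, -z.2.2.2)),
    fun z ↦ ((0, 0, z.1.2.2), (0, 0, 0)),
    fun z ↦ ((0, 0, 0), (z.2.1, z.2.2.1, z.2.2.2))]

/-- The continuous equivalence transformations
`t̃ = t e^{ε₄} + ε₁`, `x̃ = x e^{ε₅} + ε₂`, `ũ = u e^{ε₆} + ε₃`,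
`f̃ = f e^{ε₄ - 2 ε₅ + ε₇}`, `D̃ = D e^{ε₇}`, `K̃ = K e^{-ε₅ + ε₇}`. -/
def continuousTransformation (ε₁ ε₂ ε₃ ε₄ ε₅ ε₆ ε₇ : ℝ) : Equiv.Perm Ext where
  toFun z :=
    ((z.1.1 * Real.exp ε₄ + ε₁, z.1.2.1 * Real.exp ε₅ + ε₂, z.1.2.2 * Real.exp ε₆ + ε₃),
      (z.2.1 * Real.exp (ε₄ - 2 * ε₅ + ε₇), z.2.2.1 * Real.exp ε₇,
        z.2.2.2 * Real.exp (-ε₅ + ε₇)))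
  invFun z :=
    (((z.1.1 - ε₁) / Real.exp ε₄, (z.1.2.1 - ε₂) / Real.exp ε₅, (z.1.2.2 - ε₃) / Real.exp ε₆),
      (z.2.1 / Real.exp (ε₄ - 2 * ε₅ + ε₇), z.2.2.1 / Real.exp ε₇,
        z.2.2.2 / Real.exp (-ε₅ + ε₇)))
  left_inv z := by simp
  right_inv z := by simp

/-- Change of sign of `t`, `D` and `K`. -/
def signTDK : Equiv.Perm Ext where
  toFun z := ((-z.1.1, z.1.2.1, z.1.2.2), (z.2.1, -z.2.2.1, -z.2.2.2))
  invFun z := ((-z.1.1, z.1.2.1, z.1.2.2), (z.2.1, -z.2.2.1, -z.2.2.2))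
  left_inv z := by simp
  right_inv z := by simp

/-- Change of sign of `x` and `K`. -/
def signXK : Equiv.Perm Ext where
  toFun z := ((z.1.1, -z.1.2.1, z.1.2.2), (z.2.1, z.2.2.1, -z.2.2.2))
  invFun z := ((z.1.1, -z.1.2.1, z.1.2.2), (z.2.1, z.2.2.1, -z.2.2.2))
  left_inv z := by simp
  right_inv z := by simp

/-- Change of sign of `u`. -/
def signU : Equiv.Perm Ext where
  toFun z := ((z.1.1, z.1.2.1, -z.1.2.2), z.2)
  invFun z := ((z.1.1, z.1.2.1, -z.1.2.2), z.2)
  left_inv z := by simp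
  right_inv z := by simp

/-- Change of sign of `f`, `D` and `K`. -/
def signFDK : Equiv.Perm Ext where
  toFun z := (z.1, (-z.2.1, -z.2.2.1, -z.2.2.2))
  invFun z := (z.1, (-z.2.1, -z.2.2.1, -z.2.2.2))
  left_inv z := by simp
  right_inv z := by simp

/-- The group generated by the continuous transformations and the four sign changes. -/
def generatedGroup : Subgroup (Equiv.Perm Ext) :=
  Subgroup.closure
    ({ψ | ∃ ε₁ ε₂ ε₃ ε₄ ε₅ ε₆ ε₇ : ℝ, ψ = continuousTransformation ε₁ ε₂ ε₃ ε₄ ε₅ ε₆ ε₇} ∪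
      {signTDK, signXK, signU, signFDK})

end DiffConv

end

/-! Write `T, X, U` for the transformed `t, x, u` and `F, D̃, K̃` for the transformed arbitrary
elements; subscripts are partial derivatives.

Fix one equation and its image. Any jet of a target function `v'` is realised by a polynomial, and
the implicit function theorem pulls its graph back to a function `v`. The mapping property thus
becomes an identity between jets (`MapsEquationAt.jet_iff`) that holds for all free jet parameters.
Comparing coefficients of these parameters gives `T_x = T_u = 0`, then `X_u = 0`, and relations for
the coefficients of second and first order: `leading_relation`, `diffusion_relation`,
`convection_relation`.

Next the equation varies. Through each point of `W` pass equations of the class with arbitrary first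
derivatives of `f, D, K` (`testEquation`), while the value of `φ` and its derivatives at the point
are independent of this choice. Each relation therefore splits with respect to these derivatives.
This shows that `T`, `X`, `U` depend only on `t`, `x`, `u` respectively, even though dependence on
`f, D, K` was allowed, and that `D D̃_D = D̃`.

Differentiating `f D̃ T_t = F D X_x²` and `f K̃ T_t = F (D X_xx + K X_x)` then makes `T_t`, `U_u`,
`X_x` and `D̃ / D` locally constant, hence constant on the connected set `W`. So `φ` is a member of
the explicit family `scaling` (`IsEquivalence.exists_scaling`). Conversely, every scaling with
nonzero factors is an equivalence transformation, and these scalings are exactly the elements of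
`generatedGroup`.

For the Lie algebra, a local flow consists of scalings whose parameters can be read off from the
images of two points. They are therefore differentiable at time zero, and the field is locally a
combination of the generators. Analyticity extends the same combination to all of `W`. In the other
direction the flow is integrated explicitly. -/

namespace DiffConv

/-! ### Jets of transformed functions -/

/-- Implicit function theorem for one scalar equation on `Base`, solved for the last variable. -/
theorem exists_implicit_solution {G : Base → ℝ} {p : Base} (hG : ContDiffAt ℝ ∞ G p) (hp : G p = 0)
    (hu : fderiv ℝ G p (0, 0, 1) ≠ 0) :
    ∃ v : ℝ × ℝ → ℝ, v (p.1, p.2.1) = p.2.2 ∧ ContDiffAt ℝ ∞ v (p.1, p.2.1) ∧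
      ∀ᶠ s in 𝓝 (p.1, p.2.1), G (s.1, s.2, v s) = 0 := by
  let A : (ℝ × ℝ) × ℝ →L[ℝ] Base :=
    ((ContinuousLinearMap.fst ℝ ℝ ℝ).comp (ContinuousLinearMap.fst ℝ (ℝ × ℝ) ℝ)).prod
      (((ContinuousLinearMap.snd ℝ ℝ ℝ).comp (ContinuousLinearMap.fst ℝ (ℝ × ℝ) ℝ)).prod
        (ContinuousLinearMap.snd ℝ (ℝ × ℝ) ℝ))
  have hA : ∀ q, A q = (q.1.1, q.1.2, q.2) := fun q ↦ rfl
  let u : (ℝ × ℝ) × ℝ := ((p.1, p.2.1), p.2.2)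
  have hAu : A u = p := rfl
  have hG' : ContDiffAt ℝ ∞ G (A u) := hG
  have hc : ContDiffAt ℝ ∞ (fun q ↦ G (A q)) u := hG'.comp u A.contDiff.contDiffAt
  have hfd : fderiv ℝ (fun q ↦ G (A q)) u = (fderiv ℝ G p).comp A :=
    ((hG'.differentiableAt (by simp)).hasFDerivAt.comp u A.hasFDerivAt).fderiv
  have hinv : (fderiv ℝ (fun q ↦ G (A q)) u ∘L .inr ℝ (ℝ × ℝ) ℝ).IsInvertible := by
    refine ⟨ContinuousLinearEquiv.unitsEquivAut ℝ (Units.mk0 _ hu), ?_⟩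
    rw [hfd]
    ext
    simp [hA]
  refine ⟨hc.implicitFunction (by simp) hinv, hc.implicitFunction_apply_self (by simp) hinv,
    hc.contDiffAt_implicitFunction (by simp) hinv, ?_⟩
  filter_upwards [hc.eventually_apply_implicitFunction (by simp) hinv] with s hs
  rw [← hp]
  exact hs

/-- The second derivative of a function, evaluated on two vectors. -/
theorem fderiv_fderiv_apply {E F : Type*} [NormedAddCommGroup E] [NormedSpace ℝ E]
    [NormedAddCommGroup F] [NormedSpace ℝ F] {g : E → F} {p : E} (hg : ContDiffAt ℝ ∞ g p)
    (w w' : E) : fderiv ℝ (fun q ↦ fderiv ℝ g q w') p w = fderiv ℝ (fderiv ℝ g) p w w' := by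
  have h : DifferentiableAt ℝ (fderiv ℝ g) p :=
    (hg.fderiv_right (m := ∞) (by simp)).differentiableAt (by simp)
  rw [fderiv_clm_apply h (differentiableAt_const w')]
  simp

/-- First and second derivatives of a solution of `G (t, x, v) = 0`. -/
theorem implicit_derivatives {G : Base → ℝ} {p : Base} {v : ℝ × ℝ → ℝ} (hG : ContDiffAt ℝ ∞ G p)
    (hv0 : v (p.1, p.2.1) = p.2.2) (hv : ContDiffAt ℝ ∞ v (p.1, p.2.1))
    (h : ∀ᶠ s in 𝓝 (p.1, p.2.1), G (s.1, s.2, v s) = 0) :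
    ∃ (a : ℝ) (b : ℝ → ℝ) (c : ℝ),
      HasDerivAt (fun t ↦ v (t, p.2.1)) a p.1 ∧
      (∀ᶠ x in 𝓝 p.2.1, HasDerivAt (fun y ↦ v (p.1, y)) (b x) x) ∧
      HasDerivAt b c p.2.1 ∧
      fderiv ℝ G p (1, 0, a) = 0 ∧ fderiv ℝ G p (0, 1, b p.2.1) = 0 ∧
      fderiv ℝ (fderiv ℝ G) p (0, 1, b p.2.1) (0, 1, b p.2.1) + fderiv ℝ G p (0, 0, c) = 0 := by
  obtain ⟨t₀, x₀, u₀⟩ := p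
  simp only at hv0 hv h ⊢
  have hdv : DifferentiableAt ℝ v (t₀, x₀) := hv.differentiableAt (by simp)
  have evd : ∀ᶠ s in 𝓝 (t₀, x₀), DifferentiableAt ℝ v s := by
    filter_upwards [(hv.of_le (m := 1) (by simp)).eventually (by simp)] with s hs
    exact hs.differentiableAt (by simp)
  have evG : ∀ᶠ q in 𝓝 (t₀, x₀, u₀), DifferentiableAt ℝ G q := by
    filter_upwards [(hG.of_le (m := 1) (by simp)).eventually (by simp)] with s hs
    exact hs.differentiableAt (by simp)
  have hx : Filter.Tendsto (fun x : ℝ ↦ (t₀, x)) (𝓝 x₀) (𝓝 (t₀, x₀)) :=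
    (Continuous.prodMk_right t₀).continuousAt
  have ht : Filter.Tendsto (fun t : ℝ ↦ (t, x₀)) (𝓝 t₀) (𝓝 (t₀, x₀)) :=
    (Continuous.prodMk_left x₀).continuousAt
  have hct : ∀ t : ℝ, HasDerivAt (fun t : ℝ ↦ (t, x₀)) ((1 : ℝ), (0 : ℝ)) t := fun t ↦
    (hasDerivAt_id t).prodMk (hasDerivAt_const t x₀)
  have hcx : ∀ x : ℝ, HasDerivAt (fun x : ℝ ↦ (t₀, x)) ((0 : ℝ), (1 : ℝ)) x := fun x ↦
    (hasDerivAt_const x t₀).prodMk (hasDerivAt_id x)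
  have hvt : HasDerivAt (fun t ↦ v (t, x₀)) (fderiv ℝ v (t₀, x₀) (1, 0)) t₀ :=
    hdv.hasFDerivAt.comp_hasDerivAt t₀ (hct t₀)
  have hvx : ∀ᶠ x in 𝓝 x₀, HasDerivAt (fun y ↦ v (t₀, y)) (fderiv ℝ v (t₀, x) (0, 1)) x := by
    filter_upwards [hx.eventually evd] with x hxd
    exact hxd.hasFDerivAt.comp_hasDerivAt x (hcx x)
  have hvxx : HasDerivAt (fun x ↦ fderiv ℝ v (t₀, x) (0, 1))
      (fderiv ℝ (fderiv ℝ v) (t₀, x₀) (0, 1) (0, 1)) x₀ := by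
    have hd : DifferentiableAt ℝ (fun s ↦ fderiv ℝ v s (0, 1)) (t₀, x₀) :=
      ((hv.fderiv_right (m := ∞) (by simp)).differentiableAt (by simp)).clm_apply
        (differentiableAt_const _)
    rw [← fderiv_fderiv_apply hv]
    exact hd.hasFDerivAt.comp_hasDerivAt x₀ (hcx x₀)
  have hGd : DifferentiableAt ℝ G (t₀, x₀, v (t₀, x₀)) := by
    rw [hv0]; exact hG.differentiableAt (by simp)
  have hcont : Filter.Tendsto (fun x ↦ (t₀, x, v (t₀, x))) (𝓝 x₀) (𝓝 (t₀, x₀, u₀)) := by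
    rw [← hv0]
    exact ((continuousAt_const (y := t₀)).prodMk (continuousAt_id.prodMk
      (hvx.self_of_nhds.continuousAt)))
  -- Needed near `x₀` and not only at it: this identity is differentiated once more for the
  -- second-order relation.
  have hfirst : ∀ᶠ x in 𝓝 x₀,
      fderiv ℝ G (t₀, x, v (t₀, x)) (0, 1, fderiv ℝ v (t₀, x) (0, 1)) = 0 := by
    filter_upwards [hvx, (hx.eventually h).eventually_nhds, hcont.eventually evG] with x h1 h2 h3
    have h4 : HasDerivAt (fun x ↦ G (t₀, x, v (t₀, x)))
        (fderiv ℝ G (t₀, x, v (t₀, x)) (0, 1, fderiv ℝ v (t₀, x) (0, 1))) x :=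
      h3.hasFDerivAt.comp_hasDerivAt (f := fun x ↦ (t₀, x, v (t₀, x))) x
        ((hasDerivAt_const x t₀).prodMk ((hasDerivAt_id x).prodMk h1))
    have h5 : (fun x ↦ G (t₀, x, v (t₀, x))) =ᶠ[𝓝 x] fun _ ↦ (0 : ℝ) := h2
    exact h4.unique ((hasDerivAt_const x (0 : ℝ)).congr_of_eventuallyEq h5)
  refine ⟨_, fun x ↦ fderiv ℝ v (t₀, x) (0, 1), _, hvt, hvx, hvxx, ?_, ?_, ?_⟩
  · have h4 : HasDerivAt (fun t ↦ G (t, x₀, v (t, x₀)))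
        (fderiv ℝ G (t₀, x₀, v (t₀, x₀)) (1, 0, fderiv ℝ v (t₀, x₀) (1, 0))) t₀ :=
      hGd.hasFDerivAt.comp_hasDerivAt (f := fun t ↦ (t, x₀, v (t, x₀))) t₀
        ((hasDerivAt_id t₀).prodMk ((hasDerivAt_const t₀ x₀).prodMk hvt))
    have h5 : (fun t ↦ G (t, x₀, v (t, x₀))) =ᶠ[𝓝 t₀] fun _ ↦ (0 : ℝ) := ht.eventually h
    rw [hv0] at h4
    exact h4.unique ((hasDerivAt_const t₀ (0 : ℝ)).congr_of_eventuallyEq h5)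
  · have := hfirst.self_of_nhds
    rwa [hv0] at this
  · have hG2 : DifferentiableAt ℝ (fderiv ℝ G) (t₀, x₀, v (t₀, x₀)) := by
      rw [hv0]
      exact (hG.fderiv_right (m := ∞) (by simp)).differentiableAt (by simp)
    have h4 : HasDerivAt (fun x ↦ fderiv ℝ G (t₀, x, v (t₀, x)))
        (fderiv ℝ (fderiv ℝ G) (t₀, x₀, v (t₀, x₀)) (0, 1, fderiv ℝ v (t₀, x₀) (0, 1))) x₀ :=
      hG2.hasFDerivAt.comp_hasDerivAt (f := fun x ↦ (t₀, x, v (t₀, x))) x₀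
        ((hasDerivAt_const x₀ t₀).prodMk ((hasDerivAt_id x₀).prodMk hvx.self_of_nhds))
    have h6 : HasDerivAt (fun x ↦ ((0 : ℝ), (1 : ℝ), fderiv ℝ v (t₀, x) (0, 1)))
        ((0 : ℝ), (0 : ℝ), fderiv ℝ (fderiv ℝ v) (t₀, x₀) (0, 1) (0, 1)) x₀ :=
      (hasDerivAt_const x₀ (0 : ℝ)).prodMk ((hasDerivAt_const x₀ (1 : ℝ)).prodMk hvxx)
    have h7 := h4.clm_apply h6
    have h8 := h7.unique ((hasDerivAt_const x₀ (0 : ℝ)).congr_of_eventuallyEq hfirst)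
    rwa [hv0] at h8

/-- The differential equation in terms of the derivatives of `v`. -/
theorem Equation.holdsAt_iff (θ : Equation) {v : ℝ × ℝ → ℝ} {s : ℝ × ℝ} {a c : ℝ} {b : ℝ → ℝ}
    (hs : v s ∈ θ.J) (ht : HasDerivAt (fun t ↦ v (t, s.2)) a s.1)
    (hx : ∀ᶠ x in 𝓝 s.2, HasDerivAt (fun y ↦ v (s.1, y)) (b x) x) (hxx : HasDerivAt b c s.2) :
    θ.HoldsAt v s ↔
      θ.f s.2 * a = θ.D (v s) * c + deriv θ.D (v s) * b s.2 ^ 2 + θ.K (v s) * b s.2 := by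
  have hD : HasDerivAt θ.D (deriv θ.D (v (s.1, s.2))) (v (s.1, s.2)) :=
    ((θ.smooth_D.contDiffAt (θ.isOpen_J.mem_nhds hs)).differentiableAt (by simp)).hasDerivAt
  have h1 : HasDerivAt (fun x ↦ θ.D (v (s.1, x)) * b x)
      (deriv θ.D (v s) * b s.2 * b s.2 + θ.D (v s) * c) s.2 :=
    (hD.comp s.2 hx.self_of_nhds).mul hxx
  have h2 : (fun x ↦ θ.D (v (s.1, x)) * deriv (fun y ↦ v (s.1, y)) x) =ᶠ[𝓝 s.2]
      fun x ↦ θ.D (v (s.1, x)) * b x := by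
    filter_upwards [hx] with x h
    rw [h.deriv]
  rw [Equation.HoldsAt, ht.deriv, h2.deriv_eq, h1.deriv, hx.self_of_nhds.deriv]
  ring_nf

/-- The linear functional that vanishes on the tangent plane of a graph with slopes `α`, `β`. -/
def conormal (α β : ℝ) (w : Base) : ℝ := α * w.1 + β * w.2.1 - w.2.2

/-- The identification of the two differential equations, on the level of jets. -/
theorem MapsEquationAt.jet_iff {φ : Ext → Ext} {θ θ' : Equation} {p : Base}
    (h : MapsEquationAt φ θ θ' p) (hΨ : ContDiffAt ℝ ∞ (induced φ θ) p) (hp : p ∈ θ.dom)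
    {α β γ δ a b c : ℝ} (hl : conormal α β (fderiv ℝ (induced φ θ) p (0, 0, 1)) ≠ 0)
    (ha : conormal α β (fderiv ℝ (induced φ θ) p (1, 0, a)) = 0)
    (hb : conormal α β (fderiv ℝ (induced φ θ) p (0, 1, b)) = 0)
    (hc : conormal α β (fderiv ℝ (fderiv ℝ (induced φ θ)) p (0, 1, b) (0, 1, b))
      + δ * (fderiv ℝ (induced φ θ) p (0, 1, b)).1 ^ 2
      + γ * (fderiv ℝ (induced φ θ) p (0, 1, b)).2.1 ^ 2
      + c * conormal α β (fderiv ℝ (induced φ θ) p (0, 0, 1)) = 0) :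
    (θ.f p.2.1 * a = θ.D p.2.2 * c + deriv θ.D p.2.2 * b ^ 2 + θ.K p.2.2 * b) ↔
      (φ (θ.lift p)).2.1 * α = (φ (θ.lift p)).2.2.1 * γ
        + deriv θ'.D (induced φ θ p).2.2 * β ^ 2 + (φ (θ.lift p)).2.2.2 * β := by
  set Ψ := induced φ θ with hΨdef
  obtain ⟨⟨T₀, X₀, U₀⟩, hy⟩ : ∃ y, y = Ψ p := ⟨_, rfl⟩
  -- A polynomial with `v'_t = α`, `v'_x = β`, `v'_xx = γ`, `v'_tt = δ` at the image point. Its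
  -- pullback `v` is the solution of `G = 0`, and the hypotheses on `a, b, c` say that these are
  -- `v_t, v_x, v_xx`.
  set v' : ℝ × ℝ → ℝ := fun s ↦ U₀ + α * (s.1 - T₀) + β * (s.2 - X₀) + γ / 2 * (s.2 - X₀) ^ 2
    + δ / 2 * (s.1 - T₀) ^ 2 with hv'
  set G : Base → ℝ := fun q ↦ v' ((Ψ q).1, (Ψ q).2.1) - (Ψ q).2.2 with hGdef
  have hv's : ContDiff ℝ ∞ v' := by fun_prop
  have hG : ContDiffAt ℝ ∞ G p := by
    have h1 : ContDiffAt ℝ ∞ (fun q ↦ ((Ψ q).1, (Ψ q).2.1)) p := by fun_prop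
    exact (hv's.contDiffAt.comp p h1).sub (by fun_prop)
  have hG0 : G p = 0 := by simp [hGdef, hv', ← hy]
  have hG' : ∀ q w, DifferentiableAt ℝ Ψ q → fderiv ℝ G q w =
      (α + δ * ((Ψ q).1 - T₀)) * (fderiv ℝ Ψ q w).1
        + (β + γ * ((Ψ q).2.1 - X₀)) * (fderiv ℝ Ψ q w).2.1 - (fderiv ℝ Ψ q w).2.2 := by
    intro q w hq
    have hd := hq.hasFDerivAt
    have h1 := hd.fst
    have h2 := hd.snd.fst
    have h3 := hd.snd.snd
    have h4 := (((((h1.sub_const T₀).const_mul α).const_add U₀).add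
      ((h2.sub_const X₀).const_mul β)).add (((h2.sub_const X₀).pow 2).const_mul (γ / 2))).add
        (((h1.sub_const T₀).pow 2).const_mul (δ / 2)) |>.sub h3
    have h5 : fderiv ℝ G q = _ := HasFDerivAt.fderiv (f := G) h4
    rw [h5]
    simp
    ring
  have hΨd : DifferentiableAt ℝ Ψ p := hΨ.differentiableAt (by simp)
  have evΨ : ∀ᶠ q in 𝓝 p, DifferentiableAt ℝ Ψ q := by
    filter_upwards [(hΨ.of_le (m := 1) (by simp)).eventually (by simp)] with s hs
    exact hs.differentiableAt (by simp)
  have hG1 : ∀ w, fderiv ℝ G p w = conormal α β (fderiv ℝ Ψ p w) := by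
    intro w
    rw [hG' p w hΨd, ← hy]
    simp [conormal]
  have hG2 : ∀ w, fderiv ℝ (fderiv ℝ G) p w w =
      conormal α β (fderiv ℝ (fderiv ℝ Ψ) p w w) + δ * (fderiv ℝ Ψ p w).1 ^ 2
        + γ * (fderiv ℝ Ψ p w).2.1 ^ 2 := by
    intro w
    rw [← fderiv_fderiv_apply hG, ← fderiv_fderiv_apply hΨ]
    have hd := hΨd.hasFDerivAt
    have hd2 : HasFDerivAt (fun q ↦ fderiv ℝ Ψ q w) (fderiv ℝ (fun q ↦ fderiv ℝ Ψ q w) p) p :=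
      (((hΨ.fderiv_right (m := ∞) (by simp)).differentiableAt (by simp)).clm_apply
        (differentiableAt_const _)).hasFDerivAt
    have h1 := ((((((hd.fst.sub_const T₀).const_mul δ).const_add α).mul hd2.fst).add
      ((((hd.snd.fst.sub_const X₀).const_mul γ).const_add β).mul hd2.snd.fst))).sub hd2.snd.snd
    have h2 : (fun q ↦ fderiv ℝ G q w) =ᶠ[𝓝 p] _ := evΨ.mono fun q hq ↦ hG' q w hq
    have h3 := (h1.congr_of_eventuallyEq h2).fderiv
    rw [h3, ← hy]
    simp [conormal]
    ring
  have hGu : fderiv ℝ G p (0, 0, 1) ≠ 0 := by rw [hG1]; exact hl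
  obtain ⟨v, hv0, hv, hvG⟩ := exists_implicit_solution hG hG0 hGu
  obtain ⟨a', b', c', hva, hvb, hvc, ea, eb, ec⟩ := implicit_derivatives hG hv0 hv hvG
  have lin1 : ∀ r : ℝ, fderiv ℝ Ψ p (1, 0, r)
      = fderiv ℝ Ψ p (1, 0, 0) + r • fderiv ℝ Ψ p (0, 0, 1) := by
    intro r; rw [← map_smul, ← map_add]; simp
  have lin2 : ∀ r : ℝ, fderiv ℝ Ψ p (0, 1, r)
      = fderiv ℝ Ψ p (0, 1, 0) + r • fderiv ℝ Ψ p (0, 0, 1) := by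
    intro r; rw [← map_smul, ← map_add]; simp
  have lin3 : ∀ r : ℝ, fderiv ℝ Ψ p (0, 0, r) = r • fderiv ℝ Ψ p (0, 0, 1) := by
    intro r; rw [← map_smul]; simp
  have conormal_add : ∀ w w', conormal α β (w + w') = conormal α β w + conormal α β w' := by
    intro w w'; simp [conormal]; ring
  have conormal_smul : ∀ (r : ℝ) w, conormal α β (r • w) = r * conormal α β w := by
    intro r w; simp [conormal]; ring
  rw [hG1, lin1, conormal_add, conormal_smul] at ea
  rw [lin1, conormal_add, conormal_smul] at ha
  have haa : a' = a := mul_right_cancel₀ hl (by linarith)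
  have hbb : b' p.2.1 = b := by
    rw [hG1, lin2, conormal_add, conormal_smul] at eb
    rw [lin2, conormal_add, conormal_smul] at hb
    exact mul_right_cancel₀ hl (by linarith)
  have hcc : c' = c := by
    rw [hG2, hG1, lin3, conormal_smul, hbb] at ec
    exact mul_right_cancel₀ hl (by linarith)
  subst haa hcc
  have hkey := h.holds_iff v v' hv0 hv hv's.contDiffAt (hvG.mono fun s hs ↦ sub_eq_zero.mp hs)
  rw [θ.holdsAt_iff (s := (p.1, p.2.1)) (by rw [hv0]; exact hp.2) hva hvb hvc, hv0, hbb] at hkey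
  rw [hkey]
  have hlift : φ (θ.lift p) = θ'.lift (Ψ p) := h.map_lift
  have hdom : Ψ p ∈ θ'.dom := h.mem_dom
  have hv'0 : v' ((Ψ p).1, (Ψ p).2.1) = U₀ := by simp [hv', ← hy]
  have hUmem : U₀ ∈ θ'.J := by have := hdom.2; rwa [← hy] at this
  have d1 : HasDerivAt (fun t ↦ v' (t, (Ψ p).2.1)) α (Ψ p).1 := by
    have i := (hasDerivAt_id (Ψ p).1).sub_const T₀
    have := ((((i.const_mul α).const_add U₀).add_const (β * ((Ψ p).2.1 - X₀))).add_const
      (γ / 2 * ((Ψ p).2.1 - X₀) ^ 2)).add ((i.pow 2).const_mul (δ / 2))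
    exact HasDerivAt.congr_deriv this (by simp [← hy])
  have d2 : ∀ x, HasDerivAt (fun y ↦ v' ((Ψ p).1, y)) (β + γ * (x - X₀)) x := by
    intro x
    have i := (hasDerivAt_id x).sub_const X₀
    have := (((i.const_mul β).const_add (U₀ + α * ((Ψ p).1 - T₀))).add
      ((i.pow 2).const_mul (γ / 2))).add_const (δ / 2 * ((Ψ p).1 - T₀) ^ 2)
    exact HasDerivAt.congr_deriv this (by simp; ring)
  have d3 : HasDerivAt (fun x ↦ β + γ * (x - X₀)) γ (Ψ p).2.1 := by
    simpa using (((hasDerivAt_id (Ψ p).2.1).sub_const X₀).const_mul γ).const_add β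
  rw [θ'.holdsAt_iff (s := ((Ψ p).1, (Ψ p).2.1)) (by rw [hv'0]; exact hUmem) d1
    (Filter.Eventually.of_forall d2) d3, hv'0, hlift]
  simp [Equation.lift, ← hy]

/-! ### Consequences at one point: the transformed time -/

/-- If a component of a partial derivative vanishes near a point, so do the corresponding second
derivatives. -/
theorem fderiv_fderiv_eq_zero {E F G : Type*} [NormedAddCommGroup E] [NormedSpace ℝ E]
    [NormedAddCommGroup F] [NormedSpace ℝ F] [NormedAddCommGroup G] [NormedSpace ℝ G]
    {g : E → F} {p : E} (hg : ContDiffAt ℝ ∞ g p) (L : F →L[ℝ] G) {w' : E}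
    (h : ∀ᶠ q in 𝓝 p, L (fderiv ℝ g q w') = 0) (w : E) :
    L (fderiv ℝ (fderiv ℝ g) p w w') = 0 := by
  have hd : DifferentiableAt ℝ (fun q ↦ fderiv ℝ g q w') p :=
    ((hg.fderiv_right (m := ∞) (by simp)).differentiableAt (by simp)).clm_apply
      (differentiableAt_const _)
  have h1 : fderiv ℝ (fun q ↦ L (fderiv ℝ g q w')) p = _ :=
    (L.hasFDerivAt.comp p hd.hasFDerivAt).fderiv
  have h2 : (fun q ↦ L (fderiv ℝ g q w')) =ᶠ[𝓝 p] fun _ ↦ 0 := h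
  rw [h2.fderiv_eq] at h1
  rw [← fderiv_fderiv_apply hg]
  simpa using (congrArg (fun A ↦ A w) h1).symm

theorem fderiv_fderiv_symm {E F : Type*} [NormedAddCommGroup E] [NormedSpace ℝ E]
    [NormedAddCommGroup F] [NormedSpace ℝ F] {g : E → F} {p : E} (hg : ContDiffAt ℝ ∞ g p)
    (w w' : E) : fderiv ℝ (fderiv ℝ g) p w w' = fderiv ℝ (fderiv ℝ g) p w' w :=
  hg.isSymmSndFDerivAt (by simpa using ENat.LEInfty.out) w w'

namespace MapsEquationAt

variable {φ : Ext → Ext} {θ θ' : Equation} {p : Base}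

theorem transformed_f_ne_zero (h : MapsEquationAt φ θ θ' p) : (φ (θ.lift p)).2.1 ≠ 0 := by
  rw [h.map_lift]
  exact θ'.f_ne_zero _ h.mem_dom.1

theorem transformed_D_ne_zero (h : MapsEquationAt φ θ θ' p) : (φ (θ.lift p)).2.2.1 ≠ 0 := by
  rw [h.map_lift]
  exact θ'.D_ne_zero _ h.mem_dom.2

/-- The jet form of the equation, solved for the derivatives of the function `v`. -/
theorem jet_eq (h : MapsEquationAt φ θ θ' p) (hΨ : ContDiffAt ℝ ∞ (induced φ θ) p)
    (hp : p ∈ θ.dom) {α β γ b : ℝ} (δ : ℝ)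
    (hl : conormal α β (fderiv ℝ (induced φ θ) p (0, 0, 1)) ≠ 0)
    (hb : conormal α β (fderiv ℝ (induced φ θ) p (0, 1, 0))
      + b * conormal α β (fderiv ℝ (induced φ θ) p (0, 0, 1)) = 0)
    (hr : (φ (θ.lift p)).2.1 * α = (φ (θ.lift p)).2.2.1 * γ
        + deriv θ'.D (induced φ θ p).2.2 * β ^ 2 + (φ (θ.lift p)).2.2.2 * β) :
    -θ.f p.2.1 * conormal α β (fderiv ℝ (induced φ θ) p (1, 0, 0)) =
      -θ.D p.2.2 * (conormal α β (fderiv ℝ (fderiv ℝ (induced φ θ)) p (0, 1, b) (0, 1, b))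
        + δ * (fderiv ℝ (induced φ θ) p (0, 1, b)).1 ^ 2
        + γ * (fderiv ℝ (induced φ θ) p (0, 1, b)).2.1 ^ 2)
      + (deriv θ.D p.2.2 * b ^ 2 + θ.K p.2.2 * b)
        * conormal α β (fderiv ℝ (induced φ θ) p (0, 0, 1)) := by
  set A := fderiv ℝ (induced φ θ) p with hA
  have lin1 : ∀ r : ℝ, A (1, 0, r) = A (1, 0, 0) + r • A (0, 0, 1) := by
    intro r; rw [← map_smul, ← map_add]; simp
  have lin2 : ∀ r : ℝ, A (0, 1, r) = A (0, 1, 0) + r • A (0, 0, 1) := by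
    intro r; rw [← map_smul, ← map_add]; simp
  have conormal_add : ∀ w w', conormal α β (w + w') = conormal α β w + conormal α β w' := by
    intro w w'; simp [conormal]; ring
  have conormal_smul : ∀ (r : ℝ) w, conormal α β (r • w) = r * conormal α β w := by
    intro r w; simp [conormal]; ring
  set l := conormal α β (A (0, 0, 1)) with hldef
  set S := conormal α β (fderiv ℝ (fderiv ℝ (induced φ θ)) p (0, 1, b) (0, 1, b))
        + δ * (A (0, 1, b)).1 ^ 2 + γ * (A (0, 1, b)).2.1 ^ 2 with hS
  have key := (h.jet_iff hΨ hp (α := α) (β := β) (γ := γ) (δ := δ)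
    (a := -conormal α β (A (1, 0, 0)) / l) (b := b) (c := -S / l) hl
    (by rw [← hA, lin1, conormal_add, conormal_smul, ← hldef]; field_simp; ring)
    (by rw [← hA, lin2, conormal_add, conormal_smul, ← hldef]; exact hb)
    (by rw [← hA, ← hldef, ← hS]; field_simp; ring)).mpr hr
  field_simp at key
  linarith

/-- Two admissible values of `β` force both minors `Tx * Xu - Tu * Xx` and `Tx * Uu - Tu * Ux` to
vanish. Then `Tu` times the `x`-column minus `Tx` times the `u`-column is zero, and independence of
the columns finishes. The case split only supplies pairs `(α, β)` that respect the nonvanishing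
condition. -/
theorem fderiv_time_aux {Tx Tu Xx Xu Ux Uu : ℝ}
    (hinj : ∀ r s : ℝ, r * Tx + s * Tu = 0 → r * Xx + s * Xu = 0 → r * Ux + s * Uu = 0 →
      r = 0 ∧ s = 0)
    (h : ∀ α β : ℝ, α * Tu + β * Xu - Uu ≠ 0 →
      β * (Tx * Xu - Tu * Xx) = Tx * Uu - Tu * Ux) : Tx = 0 ∧ Tu = 0 := by
  have hmn : Tx * Xu - Tu * Xx = 0 ∧ Tx * Uu - Tu * Ux = 0 := by
    by_cases hU : Uu = 0
    · by_cases hX : Xu = 0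
      · by_cases hT : Tu = 0
        · have := hinj 0 1 (by simp [hT]) (by simp [hX]) (by simp [hU])
          simp at this
        · have h1 := h 1 0 (by simpa [hU] using hT)
          have h2 := h 1 1 (by simpa [hU, hX] using hT)
          constructor <;> linarith
      · have h1 := h 0 1 (by simpa [hU] using hX)
        have h2 := h 0 2 (by simpa [hU] using hX)
        constructor <;> linarith
    · have h0 := h 0 0 (by simpa using hU)
      refine ⟨?_, by linarith⟩
      by_cases h1 : Xu = Uu
      · have := h 0 (-1) (by intro h2; apply hU; linarith)
        linarith
      · have := h 0 1 (by intro h2; apply h1; linarith)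
        linarith
  have := hinj Tu (-Tx) (by ring) (by linarith [hmn.1]) (by linarith [hmn.2])
  exact ⟨by linarith [this.2], this.1⟩

theorem inj (h : MapsEquationAt φ θ θ' p) {r s : ℝ}
    (h0 : r • fderiv ℝ (induced φ θ) p (0, 1, 0) + s • fderiv ℝ (induced φ θ) p (0, 0, 1) = 0) :
    r = 0 ∧ s = 0 := by
  rw [← map_smul, ← map_smul, ← map_add] at h0
  have := h.nonsingular.1 (h0.trans (map_zero _).symm)
  simpa using this

/-- The transformed time does not depend on `x` and `u`. -/
theorem fderiv_time (h : MapsEquationAt φ θ θ' p) (hΨ : ContDiffAt ℝ ∞ (induced φ θ) p)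
    (hp : p ∈ θ.dom) :
    (fderiv ℝ (induced φ θ) p (0, 1, 0)).1 = 0 ∧ (fderiv ℝ (induced φ θ) p (0, 0, 1)).1 = 0 := by
  set A := fderiv ℝ (induced φ θ) p with hA
  refine fderiv_time_aux (Xx := (A (0, 1, 0)).2.1) (Xu := (A (0, 0, 1)).2.1)
    (Ux := (A (0, 1, 0)).2.2) (Uu := (A (0, 0, 1)).2.2) ?_ ?_
  · intro r s h1 h2 h3
    exact h.inj (Prod.ext h1 (Prod.ext h2 h3))
  · intro α β hl
    have hl' : conormal α β (A (0, 0, 1)) ≠ 0 := hl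
    obtain ⟨b, hb⟩ : ∃ b, conormal α β (A (0, 1, 0)) + b * conormal α β (A (0, 0, 1)) = 0 :=
      ⟨-conormal α β (A (0, 1, 0)) / conormal α β (A (0, 0, 1)), by field_simp; ring⟩
    have hD := h.transformed_D_ne_zero
    obtain ⟨γ, hγ⟩ : ∃ γ, (φ (θ.lift p)).2.1 * α = (φ (θ.lift p)).2.2.1 * γ
        + deriv θ'.D (induced φ θ p).2.2 * β ^ 2 + (φ (θ.lift p)).2.2.2 * β :=
      ⟨((φ (θ.lift p)).2.1 * α - deriv θ'.D (induced φ θ p).2.2 * β ^ 2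
        - (φ (θ.lift p)).2.2.2 * β) / (φ (θ.lift p)).2.2.1, by field_simp; ring⟩
    -- The target equation does not contain `v'_tt`, so `δ` is free. The values `0` and `1` differ
    -- by `D (T_x + b T_u)²`, which must vanish.
    have e0 := h.jet_eq hΨ hp 0 hl' hb hγ
    have e1 := h.jet_eq hΨ hp 1 hl' hb hγ
    rw [e0] at e1
    have h2 : θ.D p.2.2 * (A (0, 1, b)).1 ^ 2 = 0 := by linarith
    have h3 : (A (0, 1, b)).1 = 0 := by simpa [θ.D_ne_zero _ hp.2] using h2
    have lin2 : A (0, 1, b) = A (0, 1, 0) + b • A (0, 0, 1) := by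
      rw [← map_smul, ← map_add]; simp
    rw [lin2] at h3
    simp only [Prod.fst_add, Prod.smul_fst, smul_eq_mul] at h3
    simp only [conormal] at hb
    linear_combination (α * (A (0, 0, 1)).1 + β * (A (0, 0, 1)).2.1 - (A (0, 0, 1)).2.2) * h3
      - (A (0, 0, 1)).1 * hb

theorem fderiv_time_ne_zero (h : MapsEquationAt φ θ θ' p)
    (hΨ : ContDiffAt ℝ ∞ (induced φ θ) p) (hp : p ∈ θ.dom) :
    (fderiv ℝ (induced φ θ) p (1, 0, 0)).1 ≠ 0 := by
  intro h0
  obtain ⟨h1, h2⟩ := h.fderiv_time hΨ hp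
  obtain ⟨w, hw⟩ := h.nonsingular.2 (1, 0, 0)
  have hsplit : w = w.1 • ((1, 0, 0) : Base) + w.2.1 • ((0, 1, 0) : Base)
    + w.2.2 • ((0, 0, 1) : Base) := by ext <;> simp
  rw [hsplit, map_add, map_add, map_smul, map_smul, map_smul] at hw
  have := congrArg Prod.fst hw
  simp [h0, h1, h2] at this

end MapsEquationAt

/-! ### Consequences near a point: the space variable and the coefficient relations -/

/-- `θ` is mapped to `θ'` near `p`, and everything is smooth there. -/
def MapsNear (φ : Ext → Ext) (θ θ' : Equation) (p : Base) : Prop :=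
  ∀ᶠ q in 𝓝 p, MapsEquationAt φ θ θ' q ∧ ContDiffAt ℝ ∞ (induced φ θ) q ∧ q ∈ θ.dom

namespace MapsNear

variable {φ : Ext → Ext} {θ θ' : Equation} {p : Base}

theorem at_self (h : MapsNear φ θ θ' p) : MapsEquationAt φ θ θ' p := (h.self_of_nhds).1

theorem smooth (h : MapsNear φ θ θ' p) : ContDiffAt ℝ ∞ (induced φ θ) p := (h.self_of_nhds).2.1

theorem mem_dom (h : MapsNear φ θ θ' p) : p ∈ θ.dom := (h.self_of_nhds).2.2

theorem fderiv_fderiv_time (h : MapsNear φ θ θ' p) (b : ℝ) :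
    (fderiv ℝ (fderiv ℝ (induced φ θ)) p (0, 1, b) (0, 1, b)).1 = 0 := by
  refine fderiv_fderiv_eq_zero h.smooth (ContinuousLinearMap.fst ℝ ℝ (ℝ × ℝ)) ?_ _
  filter_upwards [h] with q hq
  obtain ⟨h1, h2⟩ := hq.1.fderiv_time hq.2.1 hq.2.2
  have : ((0, 1, b) : Base) = (0, 1, 0) + b • (0, 0, 1) := by simp
  rw [this, map_add, map_smul]
  simp [h1, h2]

/-- For each `γ` the target equation can be solved for `α`, since `F ≠ 0`. With `T_x`, `T_u` and the
second derivative of `T` gone, the jet identity is affine in `γ`; this is its linear coefficient. -/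
theorem space_relation (h : MapsNear φ θ θ' p) {β b : ℝ}
    (hl : β * (fderiv ℝ (induced φ θ) p (0, 0, 1)).2.1
      - (fderiv ℝ (induced φ θ) p (0, 0, 1)).2.2 ≠ 0)
    (hb : β * (fderiv ℝ (induced φ θ) p (0, 1, 0)).2.1 - (fderiv ℝ (induced φ θ) p (0, 1, 0)).2.2
      + b * (β * (fderiv ℝ (induced φ θ) p (0, 0, 1)).2.1
        - (fderiv ℝ (induced φ θ) p (0, 0, 1)).2.2) = 0) :
    θ.f p.2.1 * (φ (θ.lift p)).2.2.1 * (fderiv ℝ (induced φ θ) p (1, 0, 0)).1 =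
      (φ (θ.lift p)).2.1 * θ.D p.2.2 * ((fderiv ℝ (induced φ θ) p (0, 1, 0)).2.1
        + b * (fderiv ℝ (induced φ θ) p (0, 0, 1)).2.1) ^ 2 := by
  obtain ⟨hTx, hTu⟩ := h.at_self.fderiv_time h.smooth h.mem_dom
  have hT2 := h.fderiv_fderiv_time b
  have hf := h.at_self.transformed_f_ne_zero
  have key : ∀ γ : ℝ, _ := fun γ ↦ h.at_self.jet_eq h.smooth h.mem_dom (b := b) (β := β) (γ := γ)
    (α := ((φ (θ.lift p)).2.2.1 * γ + deriv θ'.D (induced φ θ p).2.2 * β ^ 2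
      + (φ (θ.lift p)).2.2.2 * β) / (φ (θ.lift p)).2.1) 0
    (by simpa [conormal, hTu] using hl) (by simpa [conormal, hTx, hTu] using hb)
    (by field_simp)
  have k0 := key 0
  have k1 := key 1
  have lin2 : fderiv ℝ (induced φ θ) p (0, 1, b)
      = fderiv ℝ (induced φ θ) p (0, 1, 0) + b • fderiv ℝ (induced φ θ) p (0, 0, 1) := by
    rw [← map_smul, ← map_add]; simp
  simp only [conormal, hTu, hT2] at k0 k1
  rw [lin2] at k0 k1
  simp only [Prod.snd_add, Prod.fst_add, Prod.smul_fst, Prod.smul_snd, smul_eq_mul, hTx, hTu]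
    at k0 k1
  have k2 := congrArg₂ (fun y z ↦ (y - z) * (φ (θ.lift p)).2.1) k1 k0
  field_simp at k2
  linarith

/-- The transformed space variable does not depend on `u`. -/
theorem fderiv_space (h : MapsNear φ θ θ' p) :
    (fderiv ℝ (induced φ θ) p (0, 0, 1)).2.1 = 0 := by
  obtain ⟨hTx, hTu⟩ := h.at_self.fderiv_time h.smooth h.mem_dom
  have hTt := h.at_self.fderiv_time_ne_zero h.smooth h.mem_dom
  have hf := θ.f_ne_zero _ h.mem_dom.1
  have hD := h.at_self.transformed_D_ne_zero
  by_contra hX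
  -- If `X_u ≠ 0`, the number `l = β X_u - U_u` takes every nonzero value, whereas `l (X_x + b X_u)`
  -- is a Jacobian minor up to sign and does not depend on `β`. So the left side would be
  -- independent of `l`.
  have rel : ∀ l : ℝ, l ≠ 0 →
      θ.f p.2.1 * (φ (θ.lift p)).2.2.1 * (fderiv ℝ (induced φ θ) p (1, 0, 0)).1 * l ^ 2 =
      (φ (θ.lift p)).2.1 * θ.D p.2.2 *
        ((fderiv ℝ (induced φ θ) p (0, 0, 1)).2.1 * (fderiv ℝ (induced φ θ) p (0, 1, 0)).2.2
        - (fderiv ℝ (induced φ θ) p (0, 1, 0)).2.1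
          * (fderiv ℝ (induced φ θ) p (0, 0, 1)).2.2) ^ 2 := by
    intro l hl
    set Xu := (fderiv ℝ (induced φ θ) p (0, 0, 1)).2.1
    set Uu := (fderiv ℝ (induced φ θ) p (0, 0, 1)).2.2
    set Xx := (fderiv ℝ (induced φ θ) p (0, 1, 0)).2.1
    set Ux := (fderiv ℝ (induced φ θ) p (0, 1, 0)).2.2
    have hβ : (Uu + l) / Xu * Xu - Uu = l := by field_simp; ring
    have := h.space_relation (β := (Uu + l) / Xu) (b := -((Uu + l) / Xu * Xx - Ux) / l)
      (by rw [hβ]; exact hl) (by rw [hβ]; field_simp; ring)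
    rw [this]
    field_simp
    ring
  have r1 := rel 1 one_ne_zero
  have r2 := rel 2 two_ne_zero
  rw [← r1] at r2
  have : θ.f p.2.1 * (φ (θ.lift p)).2.2.1 * (fderiv ℝ (induced φ θ) p (1, 0, 0)).1 = 0 := by
    linarith
  simp [hf, hD, hTt] at this

theorem fderiv_u_ne_zero (h : MapsNear φ θ θ' p) :
    (fderiv ℝ (induced φ θ) p (0, 0, 1)).2.2 ≠ 0 := by
  intro h0
  have h1 := h.at_self.fderiv_time h.smooth h.mem_dom
  have := h.at_self.inj (r := 0) (s := 1)
    (by rw [zero_smul, zero_add, one_smul]; exact Prod.ext h1.2 (Prod.ext h.fderiv_space h0))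
  simp at this

/-- The comparison of the coefficients of the second `x`-derivatives; once `X_u = 0`, the slope `β =
0` already gives it. -/
theorem leading_relation (h : MapsNear φ θ θ' p) :
    θ.f p.2.1 * (φ (θ.lift p)).2.2.1 * (fderiv ℝ (induced φ θ) p (1, 0, 0)).1 =
      (φ (θ.lift p)).2.1 * θ.D p.2.2 * (fderiv ℝ (induced φ θ) p (0, 1, 0)).2.1 ^ 2 := by
  have h0 := h.fderiv_u_ne_zero
  have := h.space_relation (β := 0) (b := -(fderiv ℝ (induced φ θ) p (0, 1, 0)).2.2
    / (fderiv ℝ (induced φ θ) p (0, 0, 1)).2.2) (by simpa using h0) (by field_simp; simp)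
  rw [this, h.fderiv_space]
  ring

theorem fderiv_space_ne_zero (h : MapsNear φ θ θ' p) :
    (fderiv ℝ (induced φ θ) p (0, 1, 0)).2.1 ≠ 0 := by
  intro h0
  have h1 := h.leading_relation
  simp [h0, θ.f_ne_zero _ h.mem_dom.1, h.at_self.transformed_D_ne_zero,
    h.at_self.fderiv_time_ne_zero h.smooth h.mem_dom] at h1

/-- The identity that remains after `α` is eliminated. -/
theorem slope_identity (h : MapsNear φ θ θ' p) (β b : ℝ)
    (hb : b * (fderiv ℝ (induced φ θ) p (0, 0, 1)).2.2 =
      β * (fderiv ℝ (induced φ θ) p (0, 1, 0)).2.1 - (fderiv ℝ (induced φ θ) p (0, 1, 0)).2.2) :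
    θ.f p.2.1 * ((deriv θ'.D (induced φ θ p).2.2 * β ^ 2 + (φ (θ.lift p)).2.2.2 * β)
        / (φ (θ.lift p)).2.1 * (fderiv ℝ (induced φ θ) p (1, 0, 0)).1
      + β * (fderiv ℝ (induced φ θ) p (1, 0, 0)).2.1
      - (fderiv ℝ (induced φ θ) p (1, 0, 0)).2.2) =
    θ.D p.2.2 * (β * (fderiv ℝ (fderiv ℝ (induced φ θ)) p (0, 1, 0) (0, 1, 0)).2.1
      - ((fderiv ℝ (fderiv ℝ (induced φ θ)) p (0, 1, 0) (0, 1, 0)).2.2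
        + 2 * b * (fderiv ℝ (fderiv ℝ (induced φ θ)) p (0, 0, 1) (0, 1, 0)).2.2
        + b ^ 2 * (fderiv ℝ (fderiv ℝ (induced φ θ)) p (0, 0, 1) (0, 0, 1)).2.2))
      + (deriv θ.D p.2.2 * b ^ 2 + θ.K p.2.2 * b)
        * (fderiv ℝ (induced φ θ) p (0, 0, 1)).2.2 := by
  obtain ⟨hTx, hTu⟩ := h.at_self.fderiv_time h.smooth h.mem_dom
  have hXu := h.fderiv_space
  have hT2 := h.fderiv_fderiv_time b
  have hf := h.at_self.transformed_f_ne_zero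
  have hU := h.fderiv_u_ne_zero
  have hX2 : ∀ w, (fderiv ℝ (fderiv ℝ (induced φ θ)) p w (0, 0, 1)).2.1 = 0 := by
    intro w
    refine fderiv_fderiv_eq_zero h.smooth ((ContinuousLinearMap.fst ℝ ℝ ℝ).comp
      (ContinuousLinearMap.snd ℝ ℝ (ℝ × ℝ))) ?_ _
    filter_upwards [h.eventually_nhds] with q hq
    exact MapsNear.fderiv_space hq
  have hX2' : (fderiv ℝ (fderiv ℝ (induced φ θ)) p (0, 0, 1) (0, 1, 0)).2.1 = 0 := by
    rw [fderiv_fderiv_symm h.smooth]; exact hX2 _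
  have key := h.at_self.jet_eq h.smooth h.mem_dom (b := b) (β := β) (γ := 0)
    (α := (deriv θ'.D (induced φ θ p).2.2 * β ^ 2
      + (φ (θ.lift p)).2.2.2 * β) / (φ (θ.lift p)).2.1) 0
    (by simpa [conormal, hTu, hXu] using hU)
    (by simp only [conormal, hTx, hTu, hXu]; linarith)
    (by field_simp; ring)
  have lin : ((0, 1, b) : Base) = (0, 1, 0) + b • (0, 0, 1) := by simp
  have hsecond : fderiv ℝ (fderiv ℝ (induced φ θ)) p (0, 1, b) (0, 1, b) =
      fderiv ℝ (fderiv ℝ (induced φ θ)) p (0, 1, 0) (0, 1, 0)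
      + (2 * b) • fderiv ℝ (fderiv ℝ (induced φ θ)) p (0, 0, 1) (0, 1, 0)
      + b ^ 2 • fderiv ℝ (fderiv ℝ (induced φ θ)) p (0, 0, 1) (0, 0, 1) := by
    rw [lin]
    simp only [map_add, map_smul, add_apply, smul_apply]
    rw [fderiv_fderiv_symm h.smooth (0, 1, 0) (0, 0, 1)]
    module
  simp only [conormal, hT2] at key
  rw [hsecond, lin, map_add, map_smul] at key
  simp only [Prod.snd_add, Prod.fst_add, Prod.smul_fst, Prod.smul_snd, smul_eq_mul, hTx,
    hTu, hX2, hX2', hXu] at key ⊢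
  linear_combination -key

/-- The second-order part of the identity. -/
theorem diffusion_relation (h : MapsNear φ θ θ' p) :
    θ.f p.2.1 * deriv θ'.D (induced φ θ p).2.2 * (fderiv ℝ (induced φ θ) p (1, 0, 0)).1
        * (fderiv ℝ (induced φ θ) p (0, 0, 1)).2.2 ^ 2 =
      (φ (θ.lift p)).2.1 * (fderiv ℝ (induced φ θ) p (0, 1, 0)).2.1 ^ 2 *
        (deriv θ.D p.2.2 * (fderiv ℝ (induced φ θ) p (0, 0, 1)).2.2
          - θ.D p.2.2 * (fderiv ℝ (fderiv ℝ (induced φ θ)) p (0, 0, 1) (0, 0, 1)).2.2) := by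
  have hU := h.fderiv_u_ne_zero
  have hf := h.at_self.transformed_f_ne_zero
  obtain ⟨s, hs⟩ : ∃ s, s * (fderiv ℝ (induced φ θ) p (0, 0, 1)).2.2 =
      (fderiv ℝ (induced φ θ) p (0, 1, 0)).2.1 := ⟨_, div_mul_cancel₀ _ hU⟩
  obtain ⟨b, hb⟩ : ∃ b, b * (fderiv ℝ (induced φ θ) p (0, 0, 1)).2.2 =
      (fderiv ℝ (induced φ θ) p (0, 1, 0)).2.2 := ⟨_, div_mul_cancel₀ _ hU⟩
  have hg : (φ (θ.lift p)).2.1⁻¹ * (φ (θ.lift p)).2.1 = 1 := inv_mul_cancel₀ hf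
  have key : ∀ β : ℝ, _ := fun β ↦ h.slope_identity β (β * s - b) (by rw [← hs, ← hb]; ring)
  -- Both sides are quadratic polynomials in `β`; the second difference at `-1, 0, 1` isolates the
  -- coefficient of `β ^ 2`.
  have k0 := key 0
  have k1 := key 1
  have k2 := key (-1)
  rw [← hs]
  simp only [div_eq_mul_inv] at k0 k1 k2
  linear_combination (1 / 2) * (φ (θ.lift p)).2.1 * (fderiv ℝ (induced φ θ) p (0, 0, 1)).2.2 ^ 2 *
    (k1 + k2 - 2 * k0) - θ.f p.2.1 * deriv θ'.D (induced φ θ p).2.2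
      * (fderiv ℝ (induced φ θ) p (1, 0, 0)).1 * (fderiv ℝ (induced φ θ) p (0, 0, 1)).2.2 ^ 2 * hg

/-- The first-order part of the identity, when `x̃` does not depend on `t` and `ũ` not on `x`. -/
theorem convection_relation (h : MapsNear φ θ θ' p)
    (hX : (fderiv ℝ (induced φ θ) p (1, 0, 0)).2.1 = 0)
    (hU : ∀ᶠ q in 𝓝 p, (fderiv ℝ (induced φ θ) q (0, 1, 0)).2.2 = 0) :
    θ.f p.2.1 * (φ (θ.lift p)).2.2.2 * (fderiv ℝ (induced φ θ) p (1, 0, 0)).1 =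
      (φ (θ.lift p)).2.1 *
        (θ.D p.2.2 * (fderiv ℝ (fderiv ℝ (induced φ θ)) p (0, 1, 0) (0, 1, 0)).2.1
          + θ.K p.2.2 * (fderiv ℝ (induced φ θ) p (0, 1, 0)).2.1) := by
  have hUu := h.fderiv_u_ne_zero
  have hf := h.at_self.transformed_f_ne_zero
  have hU2 : (fderiv ℝ (fderiv ℝ (induced φ θ)) p (0, 0, 1) (0, 1, 0)).2.2 = 0 :=
    fderiv_fderiv_eq_zero h.smooth ((ContinuousLinearMap.snd ℝ ℝ ℝ).comp
      (ContinuousLinearMap.snd ℝ ℝ (ℝ × ℝ))) hU _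
  have hU1 := hU.self_of_nhds
  obtain ⟨s, hs⟩ : ∃ s, s * (fderiv ℝ (induced φ θ) p (0, 0, 1)).2.2 =
      (fderiv ℝ (induced φ θ) p (0, 1, 0)).2.1 := ⟨_, div_mul_cancel₀ _ hUu⟩
  have hg : (φ (θ.lift p)).2.1⁻¹ * (φ (θ.lift p)).2.1 = 1 := inv_mul_cancel₀ hf
  have key : ∀ β : ℝ, _ := fun β ↦ h.slope_identity β (β * s) (by rw [← hs, hU1]; ring)
  -- The odd part in `β`: with `U_x` and `U_ux` zero, `b` is a multiple of `β`, so the difference at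
  -- `±1` isolates the linear coefficient.
  have k1 := key 1
  have k2 := key (-1)
  rw [← hs]
  simp only [div_eq_mul_inv, hX, hU2] at k1 k2
  linear_combination (1 / 2) * (φ (θ.lift p)).2.1 * (k1 - k2) - θ.f p.2.1 *
    (φ (θ.lift p)).2.2.2 * (fderiv ℝ (induced φ θ) p (1, 0, 0)).1 * hg

end MapsNear

/-! ### Chain rule along the graph of the arbitrary elements -/

/-- The derivative of the graph of the arbitrary elements. -/
noncomputable def Equation.liftDeriv (θ : Equation) (q w : Base) : Ext :=
  (w, (deriv θ.f q.2.1 * w.2.1, deriv θ.D q.2.2 * w.2.2, deriv θ.K q.2.2 * w.2.2))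

/-- The second derivative of the graph of the arbitrary elements. -/
noncomputable def Equation.liftDeriv₂ (θ : Equation) (q w : Base) : Ext :=
  (0, (deriv (deriv θ.f) q.2.1 * w.2.1 ^ 2, deriv (deriv θ.D) q.2.2 * w.2.2 ^ 2,
    deriv (deriv θ.K) q.2.2 * w.2.2 ^ 2))

namespace Equation

variable {θ : Equation} {q : Base}

theorem contDiffAt_f (hq : q ∈ θ.dom) : ContDiffAt ℝ ∞ θ.f q.2.1 :=
  θ.smooth_f.contDiffAt (θ.isOpen_I.mem_nhds hq.1)

theorem contDiffAt_D (hq : q ∈ θ.dom) : ContDiffAt ℝ ∞ θ.D q.2.2 :=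
  θ.smooth_D.contDiffAt (θ.isOpen_J.mem_nhds hq.2)

theorem contDiffAt_K (hq : q ∈ θ.dom) : ContDiffAt ℝ ∞ θ.K q.2.2 :=
  θ.smooth_K.contDiffAt (θ.isOpen_J.mem_nhds hq.2)

theorem isOpen_dom (θ : Equation) : IsOpen θ.dom :=
  (θ.isOpen_I.preimage (by fun_prop : Continuous fun p : Base ↦ p.2.1)).inter
    (θ.isOpen_J.preimage (by fun_prop : Continuous fun p : Base ↦ p.2.2))

theorem contDiffAt_lift (hq : q ∈ θ.dom) : ContDiffAt ℝ ∞ θ.lift q := by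
  have h1 : ContDiffAt ℝ ∞ (fun q : Base ↦ q.2.1) q := by fun_prop
  have h2 : ContDiffAt ℝ ∞ (fun q : Base ↦ q.2.2) q := by fun_prop
  exact contDiffAt_id.prodMk (((contDiffAt_f hq).comp q h1).prodMk
    (((contDiffAt_D hq).comp q h2).prodMk ((contDiffAt_K hq).comp q h2)))

theorem fderiv_lift (hq : q ∈ θ.dom) (w : Base) : fderiv ℝ θ.lift q w = θ.liftDeriv q w := by
  have h1 := ((ContinuousLinearMap.fst ℝ ℝ ℝ).comp
    (ContinuousLinearMap.snd ℝ ℝ (ℝ × ℝ))).hasFDerivAt (x := q)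
  have h2 := ((ContinuousLinearMap.snd ℝ ℝ ℝ).comp
    (ContinuousLinearMap.snd ℝ ℝ (ℝ × ℝ))).hasFDerivAt (x := q)
  have hf := ((contDiffAt_f hq).differentiableAt (by simp)).hasDerivAt.comp_hasFDerivAt q h1
  have hD := ((contDiffAt_D hq).differentiableAt (by simp)).hasDerivAt.comp_hasFDerivAt q h2
  have hK := ((contDiffAt_K hq).differentiableAt (by simp)).hasDerivAt.comp_hasFDerivAt q h2
  have h : HasFDerivAt θ.lift _ q := (hasFDerivAt_id q).prodMk (hf.prodMk (hD.prodMk hK))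
  rw [h.fderiv]
  simp [liftDeriv]

theorem differentiableAt_deriv {g : ℝ → ℝ} {x : ℝ} (hg : ContDiffAt ℝ ∞ g x) :
    DifferentiableAt ℝ (deriv g) x := by
  have h : ContDiffAt ℝ ∞ (fun y ↦ fderiv ℝ g y 1) x :=
    (hg.fderiv_right (m := ∞) (by simp)).clm_apply contDiffAt_const
  exact h.differentiableAt (by simp)

theorem hasFDerivAt_liftDeriv (hq : q ∈ θ.dom) (w : Base) :
    ∃ B : Base →L[ℝ] Ext, HasFDerivAt (fun q ↦ θ.liftDeriv q w) B q ∧ B w = θ.liftDeriv₂ q w := by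
  have h1 := ((ContinuousLinearMap.fst ℝ ℝ ℝ).comp
    (ContinuousLinearMap.snd ℝ ℝ (ℝ × ℝ))).hasFDerivAt (x := q)
  have h2 := ((ContinuousLinearMap.snd ℝ ℝ ℝ).comp
    (ContinuousLinearMap.snd ℝ ℝ (ℝ × ℝ))).hasFDerivAt (x := q)
  have hf := (differentiableAt_deriv (contDiffAt_f hq)).hasDerivAt.comp_hasFDerivAt q h1
  have hD := (differentiableAt_deriv (contDiffAt_D hq)).hasDerivAt.comp_hasFDerivAt q h2
  have hK := (differentiableAt_deriv (contDiffAt_K hq)).hasDerivAt.comp_hasFDerivAt q h2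
  refine ⟨_, (hasFDerivAt_const w q).prodMk ((hf.mul_const w.2.1).prodMk
    ((hD.mul_const w.2.2).prodMk (hK.mul_const w.2.2))), ?_⟩
  simp [liftDeriv₂]
  refine ⟨?_, ?_, ?_⟩ <;> ring

end Equation

variable {φ : Ext → Ext} {W : Set Ext} {θ θ' : Equation} {p : Base}

theorem fderiv_induced (hφ : ContDiffAt ℝ ∞ φ (θ.lift p)) (hp : p ∈ θ.dom) (w : Base) :
    fderiv ℝ (induced φ θ) p w = (fderiv ℝ φ (θ.lift p) (θ.liftDeriv p w)).1 := by
  have h1 := ((Equation.contDiffAt_lift hp).differentiableAt (by simp)).hasFDerivAt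
  have h2 := (hφ.differentiableAt (by simp)).hasFDerivAt
  have h3 : HasFDerivAt (induced φ θ) _ p := (h2.comp p h1).fst
  rw [h3.fderiv, ← Equation.fderiv_lift hp]
  rfl

theorem eventually_lift_mem (hW : IsOpen W) (hp : p ∈ θ.dom) (hpW : θ.lift p ∈ W) :
    ∀ᶠ q in 𝓝 p, q ∈ θ.dom ∧ θ.lift q ∈ W :=
  Filter.Eventually.and (θ.isOpen_dom.mem_nhds hp)
    ((Equation.contDiffAt_lift hp).continuousAt.eventually_mem (hW.mem_nhds hpW))

/-- Besides the second derivative of `φ` along the lifted direction, the curvature of the graph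
contributes, through the second derivatives of `f, D, K`. -/
theorem fderiv_fderiv_induced (hW : IsOpen W) (hφ : ContDiffOn ℝ ∞ φ W) (hp : p ∈ θ.dom)
    (hpW : θ.lift p ∈ W) (w : Base) :
    fderiv ℝ (fderiv ℝ (induced φ θ)) p w w =
      (fderiv ℝ (fderiv ℝ φ) (θ.lift p) (θ.liftDeriv p w) (θ.liftDeriv p w)
        + fderiv ℝ φ (θ.lift p) (θ.liftDeriv₂ p w)).1 := by
  have hφp : ContDiffAt ℝ ∞ φ (θ.lift p) := hφ.contDiffAt (hW.mem_nhds hpW)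
  have hΨ : ContDiffAt ℝ ∞ (induced φ θ) p := (hφp.comp p (Equation.contDiffAt_lift hp)).fst
  rw [← fderiv_fderiv_apply hΨ]
  have hev : (fun q ↦ fderiv ℝ (induced φ θ) q w) =ᶠ[𝓝 p]
      fun q ↦ (fderiv ℝ φ (θ.lift q) (θ.liftDeriv q w)).1 := by
    filter_upwards [eventually_lift_mem hW hp hpW] with q hq
    exact fderiv_induced (hφ.contDiffAt (hW.mem_nhds hq.2)) hq.1 w
  obtain ⟨B, hB, hBw⟩ := Equation.hasFDerivAt_liftDeriv hp w
  have h1 := ((Equation.contDiffAt_lift hp).differentiableAt (by simp)).hasFDerivAt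
  have h2 : HasFDerivAt (fderiv ℝ φ) _ (θ.lift p) :=
    ((hφp.fderiv_right (m := ∞) (by simp)).differentiableAt (by simp)).hasFDerivAt
  have h3 := ((h2.comp p h1).clm_apply hB).fst
  rw [(h3.congr_of_eventuallyEq hev).fderiv]
  simp [Equation.fderiv_lift hp, hBw, add_comm]

theorem IsEquivalence.exists_mapsNear (h : IsEquivalence φ W) (hW : IsOpen W) (hp : p ∈ θ.dom)
    (hpW : θ.lift p ∈ W) : ∃ θ' : Equation, MapsNear φ θ θ' p := by
  obtain ⟨θ', hθ'⟩ := h.maps_class θ p hp hpW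
  refine ⟨θ', ?_⟩
  filter_upwards [hθ', eventually_lift_mem hW hp hpW] with q h1 h2
  exact ⟨h1, ((h.smooth.contDiffAt (hW.mem_nhds h2.2)).comp q
    (Equation.contDiffAt_lift h2.1)).fst, h2.1⟩

/-- The transformed arbitrary elements depend on the transformed variables only through
`x̃` and `ũ`, respectively. -/
theorem MapsNear.fderiv_elements (h : MapsNear φ θ θ' p) (hφ : ContDiffAt ℝ ∞ φ (θ.lift p))
    (w : Base) :
    (fderiv ℝ φ (θ.lift p) (θ.liftDeriv p w)).2 =
      (deriv θ'.f (induced φ θ p).2.1 * (fderiv ℝ φ (θ.lift p) (θ.liftDeriv p w)).1.2.1,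
        deriv θ'.D (induced φ θ p).2.2 * (fderiv ℝ φ (θ.lift p) (θ.liftDeriv p w)).1.2.2,
        deriv θ'.K (induced φ θ p).2.2 * (fderiv ℝ φ (θ.lift p) (θ.liftDeriv p w)).1.2.2) := by
  have h1 := ((Equation.contDiffAt_lift h.mem_dom).differentiableAt (by simp)).hasFDerivAt
  have h2 := (hφ.differentiableAt (by simp)).hasFDerivAt
  have h3 : HasFDerivAt (fun q ↦ φ (θ.lift q)) _ p := h2.comp p h1
  have hev : (fun q ↦ φ (θ.lift q)) =ᶠ[𝓝 p] fun q ↦ θ'.lift (induced φ θ q) :=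
    Filter.Eventually.mono h fun q hq ↦ hq.1.map_lift
  have h4 := ((Equation.contDiffAt_lift h.at_self.mem_dom).differentiableAt (by simp)).hasFDerivAt
  have h5 := (h.smooth.differentiableAt (by simp)).hasFDerivAt
  have h6 := (h4.comp p h5).congr_of_eventuallyEq hev
  have h7 := congrArg (fun A ↦ (A w).2) (h3.unique h6)
  simp only [ContinuousLinearMap.comp_apply, Equation.fderiv_lift h.mem_dom,
    Equation.fderiv_lift h.at_self.mem_dom, fderiv_induced hφ h.mem_dom] at h7
  exact h7

/-! ### Test equations with prescribed derivatives at a point -/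

/-- An equation of the class through the point `z` with prescribed derivatives of the arbitrary
elements. -/
noncomputable def testEquation (z : Ext) (hz : z ∈ regular) (f₁ D₁ r K₁ k : ℝ) : Equation where
  I := Set.univ
  J := Set.univ
  -- The exponentials keep `f` and `D` nowhere zero. The cubic term of `K` guarantees nonlinearity
  -- for every choice of parameters without changing the derivatives of order at most two at the
  -- base point.
  f x := z.2.1 * Real.exp (f₁ / z.2.1 * (x - z.1.2.1))
  D u := z.2.2.1 * Real.exp (D₁ / z.2.2.1 * (u - z.1.2.2) + r * (u - z.1.2.2) ^ 2)
  K u := z.2.2.2 + K₁ * (u - z.1.2.2) + k * (u - z.1.2.2) ^ 2 + (u - z.1.2.2) ^ 3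
  isOpen_I := isOpen_univ
  isOpen_J := isOpen_univ
  isPreconnected_I := isPreconnected_univ
  isPreconnected_J := isPreconnected_univ
  smooth_f := by fun_prop
  smooth_D := by fun_prop
  smooth_K := by fun_prop
  f_ne_zero x _ := mul_ne_zero hz.1 (Real.exp_ne_zero _)
  D_ne_zero u _ := mul_ne_zero hz.2 (Real.exp_ne_zero _)
  nonlinear := by
    have hd : ∀ u, deriv (fun u ↦ z.2.2.2 + K₁ * (u - z.1.2.2) + k * (u - z.1.2.2) ^ 2
        + (u - z.1.2.2) ^ 3) u
        = K₁ + 2 * k * (u - z.1.2.2) + 3 * (u - z.1.2.2) ^ 2 := by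
      intro u
      have i := (hasDerivAt_id u).sub_const z.1.2.2
      have := (((i.const_mul K₁).const_add z.2.2.2).add ((i.pow 2).const_mul k)).add (i.pow 3)
      refine (HasDerivAt.congr_deriv this ?_).deriv
      simp
      ring
    by_contra hcon
    push Not at hcon
    -- The second difference of the derivative of `K` equals `6` for all `K₁`, `k`, so the three
    -- values cannot all be zero.
    have h0 := (hcon z.1.2.2 trivial).2
    have h1 := (hcon (z.1.2.2 + 1) trivial).2
    have h2 := (hcon (z.1.2.2 - 1) trivial).2
    rw [hd] at h0 h1 h2
    ring_nf at h0 h1 h2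
    linarith

section testEquation

variable {z : Ext} (hz : z ∈ regular) (f₁ D₁ r K₁ k : ℝ)

theorem testEquation_mem_dom (q : Base) : q ∈ (testEquation z hz f₁ D₁ r K₁ k).dom :=
  ⟨trivial, trivial⟩

theorem testEquation_lift : (testEquation z hz f₁ D₁ r K₁ k).lift z.1 = z := by
  simp [Equation.lift, testEquation]

theorem testEquation_hasDerivAt_f (x : ℝ) :
    HasDerivAt (testEquation z hz f₁ D₁ r K₁ k).f
      (f₁ * Real.exp (f₁ / z.2.1 * (x - z.1.2.1))) x := by
  have h := ((((hasDerivAt_id x).sub_const z.1.2.1).const_mul (f₁ / z.2.1)).exp).const_mul z.2.1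
  refine HasDerivAt.congr_deriv h ?_
  have := hz.1
  simp
  field_simp

theorem testEquation_hasDerivAt_D (u : ℝ) :
    HasDerivAt (testEquation z hz f₁ D₁ r K₁ k).D
      ((D₁ + 2 * r * z.2.2.1 * (u - z.1.2.2))
        * Real.exp (D₁ / z.2.2.1 * (u - z.1.2.2) + r * (u - z.1.2.2) ^ 2)) u := by
  have i := (hasDerivAt_id u).sub_const z.1.2.2
  have h := (((i.const_mul (D₁ / z.2.2.1)).add ((i.pow 2).const_mul r)).exp).const_mul z.2.2.1
  refine HasDerivAt.congr_deriv h ?_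
  have := hz.2
  simp
  field_simp

theorem testEquation_hasDerivAt_K (u : ℝ) :
    HasDerivAt (testEquation z hz f₁ D₁ r K₁ k).K
      (K₁ + 2 * k * (u - z.1.2.2) + 3 * (u - z.1.2.2) ^ 2) u := by
  have i := (hasDerivAt_id u).sub_const z.1.2.2
  have := (((i.const_mul K₁).const_add z.2.2.2).add ((i.pow 2).const_mul k)).add (i.pow 3)
  refine HasDerivAt.congr_deriv this ?_
  simp
  ring

theorem testEquation_liftDeriv (w : Base) :
    (testEquation z hz f₁ D₁ r K₁ k).liftDeriv z.1 w = (w, (f₁ * w.2.1, D₁ * w.2.2, K₁ * w.2.2)) := by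
  simp [Equation.liftDeriv, (testEquation_hasDerivAt_f hz f₁ D₁ r K₁ k _).deriv,
    (testEquation_hasDerivAt_D hz f₁ D₁ r K₁ k _).deriv,
    (testEquation_hasDerivAt_K hz f₁ D₁ r K₁ k _).deriv]

theorem testEquation_liftDeriv₂ (w : Base) :
    (testEquation z hz 0 0 r K₁ k).liftDeriv₂ z.1 w =
      (0, (0, 2 * r * z.2.2.1 * w.2.2 ^ 2, 2 * k * w.2.2 ^ 2)) := by
  have hf : deriv (testEquation z hz 0 0 r K₁ k).f = fun _ ↦ 0 := by
    funext x
    rw [(testEquation_hasDerivAt_f hz 0 0 r K₁ k x).deriv, zero_mul]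
  have hD : deriv (testEquation z hz 0 0 r K₁ k).D = fun u ↦
      2 * r * z.2.2.1 * (u - z.1.2.2) * Real.exp (r * (u - z.1.2.2) ^ 2) := by
    funext u
    rw [(testEquation_hasDerivAt_D hz 0 0 r K₁ k u).deriv]
    simp
  have hK : deriv (testEquation z hz 0 0 r K₁ k).K = fun u ↦
      K₁ + 2 * k * (u - z.1.2.2) + 3 * (u - z.1.2.2) ^ 2 :=
    funext fun u ↦ (testEquation_hasDerivAt_K hz 0 0 r K₁ k u).deriv
  have i := (hasDerivAt_id z.1.2.2).sub_const z.1.2.2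
  have hD2 : HasDerivAt (fun u ↦ 2 * r * z.2.2.1 * (u - z.1.2.2)
      * Real.exp (r * (u - z.1.2.2) ^ 2)) (2 * r * z.2.2.1) z.1.2.2 :=
    HasDerivAt.congr_deriv
      ((i.const_mul (2 * r * z.2.2.1)).mul (((i.pow 2).const_mul r).exp)) (by simp)
  have hK2 : HasDerivAt (fun u ↦ K₁ + 2 * k * (u - z.1.2.2) + 3 * (u - z.1.2.2) ^ 2)
      (2 * k) z.1.2.2 :=
    HasDerivAt.congr_deriv
      (((i.const_mul (2 * k)).const_add K₁).add ((i.pow 2).const_mul 3)) (by simp)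
  simp [Equation.liftDeriv₂, hf, hD, hK, hD2.deriv, hK2.deriv]

end testEquation

/-! ### First derivatives of an equivalence transformation -/

namespace IsEquivalence

variable {φ : Ext → Ext} {W : Set Ext} {z : Ext}

/-- First-order consequences of the mapping property, for prescribed first derivatives of the
arbitrary elements. -/
theorem first_order (h : IsEquivalence φ W) (hW : IsOpen W) (hz : z ∈ W) (hr : z ∈ regular)
    (f₁ D₁ K₁ : ℝ) :
    ∃ Lt Lx Lu : Ext, Lt = fderiv ℝ φ z ((1, 0, 0), (0, 0, 0)) ∧
      Lx = fderiv ℝ φ z ((0, 1, 0), (0, 0, 0)) + f₁ • fderiv ℝ φ z ((0, 0, 0), (1, 0, 0)) ∧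
      Lu = fderiv ℝ φ z ((0, 0, 1), (0, 0, 0)) + D₁ • fderiv ℝ φ z ((0, 0, 0), (0, 1, 0))
        + K₁ • fderiv ℝ φ z ((0, 0, 0), (0, 0, 1)) ∧
      (Lt.1.1 ≠ 0 ∧ Lx.1.1 = 0 ∧ Lu.1.1 = 0) ∧ (Lx.1.2.1 ≠ 0 ∧ Lu.1.2.1 = 0) ∧ Lu.1.2.2 ≠ 0 ∧
      z.2.1 * (φ z).2.2.1 * Lt.1.1 = (φ z).2.1 * z.2.2.1 * Lx.1.2.1 ^ 2 ∧
      ∃ F' D' K' : ℝ, Lt.2 = (F' * Lt.1.2.1, D' * Lt.1.2.2, K' * Lt.1.2.2) ∧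
        Lx.2 = (F' * Lx.1.2.1, D' * Lx.1.2.2, K' * Lx.1.2.2) ∧
        Lu.2 = (F' * Lu.1.2.1, D' * Lu.1.2.2, K' * Lu.1.2.2) := by
  set θ := testEquation z hr f₁ D₁ 0 K₁ 0
  have hl : θ.lift z.1 = z := testEquation_lift hr f₁ D₁ 0 K₁ 0
  have hdom : z.1 ∈ θ.dom := testEquation_mem_dom hr f₁ D₁ 0 K₁ 0 z.1
  obtain ⟨θ', hm⟩ := h.exists_mapsNear (θ := θ) (p := z.1) hW hdom (by rw [hl]; exact hz)
  have hφ : ContDiffAt ℝ ∞ φ (θ.lift z.1) := by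
    rw [hl]; exact h.smooth.contDiffAt (hW.mem_nhds hz)
  have hd := fderiv_induced hφ hdom
  have he := hm.fderiv_elements hφ
  have hL : ∀ w, θ.liftDeriv z.1 w = (w, (f₁ * w.2.1, D₁ * w.2.2, K₁ * w.2.2)) :=
    testEquation_liftDeriv hr f₁ D₁ 0 K₁ 0
  simp only [hl, hL] at hd he
  have hx : fderiv ℝ φ z ((0, 1, 0), (f₁ * 1, D₁ * 0, K₁ * 0)) =
      fderiv ℝ φ z ((0, 1, 0), (0, 0, 0)) + f₁ • fderiv ℝ φ z ((0, 0, 0), (1, 0, 0)) := by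
    rw [← map_smul, ← map_add]; simp
  have hu : fderiv ℝ φ z ((0, 0, 1), (f₁ * 0, D₁ * 1, K₁ * 1)) =
      fderiv ℝ φ z ((0, 0, 1), (0, 0, 0)) + D₁ • fderiv ℝ φ z ((0, 0, 0), (0, 1, 0))
        + K₁ • fderiv ℝ φ z ((0, 0, 0), (0, 0, 1)) := by
    rw [← map_smul, ← map_smul, ← map_add, ← map_add]; simp
  have ht : fderiv ℝ φ z ((1, 0, 0), (f₁ * 0, D₁ * 0, K₁ * 0)) =
      fderiv ℝ φ z ((1, 0, 0), (0, 0, 0)) := by simp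
  have dt := hd (1, 0, 0)
  have dx := hd (0, 1, 0)
  have du := hd (0, 0, 1)
  have et := he (1, 0, 0)
  have ex := he (0, 1, 0)
  have eu := he (0, 0, 1)
  simp only [ht, hx, hu] at dt dx du et ex eu
  have time := hm.at_self.fderiv_time hm.smooth hm.mem_dom
  have time' := hm.at_self.fderiv_time_ne_zero hm.smooth hm.mem_dom
  have space := hm.fderiv_space
  have space' := hm.fderiv_space_ne_zero
  have uu := hm.fderiv_u_ne_zero
  have lead := hm.leading_relation
  have hzf : θ.f z.1.2.1 = z.2.1 := congrArg (fun z ↦ z.2.1) hl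
  have hzD : θ.D z.1.2.2 = z.2.2.1 := congrArg (fun z ↦ z.2.2.1) hl
  rw [hl, hzf, hzD] at lead
  rw [dt] at time' lead
  rw [dx] at time space' lead
  rw [du] at time space uu
  exact ⟨_, _, _, rfl, rfl, rfl, ⟨time', time.1, time.2⟩, ⟨space', space⟩, uu, lead,
    _, _, _, et, ex, eu⟩

theorem transformed_ne_zero (h : IsEquivalence φ W) (hW : IsOpen W) (hz : z ∈ W)
    (hr : z ∈ regular) : φ z ∈ regular := by
  have hl : (testEquation z hr 0 0 0 0 0).lift z.1 = z := testEquation_lift hr 0 0 0 0 0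
  obtain ⟨θ', hm⟩ := h.exists_mapsNear (p := z.1) hW
    (testEquation_mem_dom hr 0 0 0 0 0 z.1) (by rw [hl]; exact hz)
  have hf := hm.at_self.transformed_f_ne_zero
  have hD := hm.at_self.transformed_D_ne_zero
  rw [hl] at hf hD
  exact ⟨hf, hD⟩

/-- Second-order consequence of the mapping property. -/
theorem second_order (h : IsEquivalence φ W) (hW : IsOpen W) (hz : z ∈ W) (hr : z ∈ regular)
    (D₁ r K₁ k : ℝ) {Lu : Ext} (hLu : Lu = fderiv ℝ φ z ((0, 0, 1), (0, D₁, K₁))) :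
    z.2.2.1 * Lu.2.2.1 * Lu.1.2.2 = (φ z).2.2.1 * (D₁ * Lu.1.2.2 - z.2.2.1 *
      (fderiv ℝ (fderiv ℝ φ) z ((0, 0, 1), (0, D₁, K₁)) ((0, 0, 1), (0, D₁, K₁))
        + fderiv ℝ φ z ((testEquation z hr 0 D₁ r K₁ k).liftDeriv₂ z.1 (0, 0, 1))).1.2.2) := by
  set θ := testEquation z hr 0 D₁ r K₁ k with hθ
  have hl : θ.lift z.1 = z := testEquation_lift hr 0 D₁ r K₁ k
  have hdom : z.1 ∈ θ.dom := testEquation_mem_dom hr 0 D₁ r K₁ k z.1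
  obtain ⟨θ', hm⟩ := h.exists_mapsNear (θ := θ) (p := z.1) hW hdom (by rw [hl]; exact hz)
  have hφ : ContDiffAt ℝ ∞ φ (θ.lift z.1) := by
    rw [hl]; exact h.smooth.contDiffAt (hW.mem_nhds hz)
  have hd := fderiv_induced hφ hdom (0, 0, 1)
  have he := hm.fderiv_elements hφ (0, 0, 1)
  have hd2 := fderiv_fderiv_induced hW h.smooth hdom (by rw [hl]; exact hz) (0, 0, 1)
  have hL : θ.liftDeriv z.1 (0, 0, 1) = ((0, 0, 1), (0, D₁, K₁)) := by
    simp [hθ, testEquation_liftDeriv]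
  simp only [hl, hL, ← hLu] at hd he hd2
  have lead := hm.leading_relation
  have diff := hm.diffusion_relation
  have hzf : θ.f z.1.2.1 = z.2.1 := congrArg (fun z ↦ z.2.1) hl
  have hzD : θ.D z.1.2.2 = z.2.2.1 := congrArg (fun z ↦ z.2.2.1) hl
  have hdD : deriv θ.D z.1.2.2 = D₁ := by
    simp [hθ, (testEquation_hasDerivAt_D hr 0 D₁ r K₁ k _).deriv]
  rw [hl, hzf, hzD] at lead diff
  rw [hd2, hd, hdD] at diff
  have hT := hm.at_self.fderiv_time_ne_zero hm.smooth hm.mem_dom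
  have e1 : Lu.2.2.1 = _ := congrArg (fun y ↦ y.2.1) he
  rw [e1]
  have hne : z.2.1 * (fderiv ℝ (induced φ θ) z.1 (1, 0, 0)).1 ≠ 0 := mul_ne_zero hr.1 hT
  apply mul_left_cancel₀ hne
  simp only at diff ⊢
  linear_combination z.2.2.1 * diff - (D₁ * Lu.1.2.2 - z.2.2.1 *
      (fderiv ℝ (fderiv ℝ φ) z ((0, 0, 1), (0, D₁, K₁)) ((0, 0, 1), (0, D₁, K₁))
        + fderiv ℝ φ z (θ.liftDeriv₂ z.1 (0, 0, 1))).1.2.2) * lead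

/-- The total derivatives `T_x + f₁ T_f` and `T_u + D₁ T_D + K₁ T_K` vanish for all `f₁, D₁, K₁`, so
each term vanishes separately. -/
theorem fderiv_T (h : IsEquivalence φ W) (hW : IsOpen W) (hz : z ∈ W) (hr : z ∈ regular) :
    (fderiv ℝ φ z ((1, 0, 0), (0, 0, 0))).1.1 ≠ 0 ∧
    (fderiv ℝ φ z ((0, 1, 0), (0, 0, 0))).1.1 = 0 ∧
    (fderiv ℝ φ z ((0, 0, 1), (0, 0, 0))).1.1 = 0 ∧
    (fderiv ℝ φ z ((0, 0, 0), (1, 0, 0))).1.1 = 0 ∧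
    (fderiv ℝ φ z ((0, 0, 0), (0, 1, 0))).1.1 = 0 ∧
    (fderiv ℝ φ z ((0, 0, 0), (0, 0, 1))).1.1 = 0 := by
  obtain ⟨_, _, _, rfl, rfl, rfl, ⟨a1, a2, a3⟩, -⟩ := h.first_order hW hz hr 0 0 0
  obtain ⟨_, _, _, rfl, rfl, rfl, ⟨-, b2, -⟩, -⟩ := h.first_order hW hz hr 1 0 0
  obtain ⟨_, _, _, rfl, rfl, rfl, ⟨-, -, c3⟩, -⟩ := h.first_order hW hz hr 0 1 0
  obtain ⟨_, _, _, rfl, rfl, rfl, ⟨-, -, d3⟩, -⟩ := h.first_order hW hz hr 0 0 1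
  simp only [zero_smul, add_zero, one_smul, Prod.fst_add] at a2 a3 b2 c3 d3
  exact ⟨a1, a2, a3, by linarith, by linarith, by linarith⟩

/-- `X_u`, `X_D`, `X_K` split off as for `T`. For `X_f`, the leading relation says that `(X_x + f₁
X_f)²` is independent of `f₁`; its second difference at `f₁ = -1, 0, 1` gives `X_f = 0`. -/
theorem fderiv_X_aux (h : IsEquivalence φ W) (hW : IsOpen W) (hz : z ∈ W) (hr : z ∈ regular) :
    (fderiv ℝ φ z ((0, 1, 0), (0, 0, 0))).1.2.1 ≠ 0 ∧
    (fderiv ℝ φ z ((0, 0, 1), (0, 0, 0))).1.2.1 = 0 ∧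
    (fderiv ℝ φ z ((0, 0, 0), (1, 0, 0))).1.2.1 = 0 ∧
    (fderiv ℝ φ z ((0, 0, 0), (0, 1, 0))).1.2.1 = 0 ∧
    (fderiv ℝ φ z ((0, 0, 0), (0, 0, 1))).1.2.1 = 0 := by
  obtain ⟨_, _, _, rfl, rfl, rfl, -, ⟨a2, a3⟩, -, a4, -⟩ := h.first_order hW hz hr 0 0 0
  obtain ⟨_, _, _, rfl, rfl, rfl, -, ⟨-, -⟩, -, b4, -⟩ := h.first_order hW hz hr 1 0 0
  obtain ⟨_, _, _, rfl, rfl, rfl, -, ⟨-, -⟩, -, b5, -⟩ := h.first_order hW hz hr (-1) 0 0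
  obtain ⟨_, _, _, rfl, rfl, rfl, -, ⟨-, c3⟩, -⟩ := h.first_order hW hz hr 0 1 0
  obtain ⟨_, _, _, rfl, rfl, rfl, -, ⟨-, d3⟩, -⟩ := h.first_order hW hz hr 0 0 1
  simp only [zero_smul, add_zero, one_smul, neg_smul, Prod.fst_add, Prod.snd_add, Prod.fst_neg,
    Prod.snd_neg] at a2 a3 a4 b4 b5 c3 d3
  have hreg := h.transformed_ne_zero hW hz hr
  have key : (φ z).2.1 * z.2.2.1 * (fderiv ℝ φ z ((0, 0, 0), (1, 0, 0))).1.2.1 ^ 2 = 0 := by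
    linear_combination a4 - (1 / 2) * b4 - (1 / 2) * b5
  have hf : (fderiv ℝ φ z ((0, 0, 0), (1, 0, 0))).1.2.1 = 0 := by
    simpa [hreg.1, hr.2] using key
  exact ⟨a2, a3, hf, by linarith, by linarith⟩

theorem decompose (w : Ext) : w = w.1.1 • (((1, 0, 0), (0, 0, 0)) : Ext)
    + w.1.2.1 • (((0, 1, 0), (0, 0, 0)) : Ext) + w.1.2.2 • (((0, 0, 1), (0, 0, 0)) : Ext)
    + w.2.1 • (((0, 0, 0), (1, 0, 0)) : Ext) + w.2.2.1 • (((0, 0, 0), (0, 1, 0)) : Ext)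
    + w.2.2.2 • (((0, 0, 0), (0, 0, 1)) : Ext) := by
  ext <;> simp

theorem map_decompose {F : Type*} [NormedAddCommGroup F] [NormedSpace ℝ F] (A : Ext →L[ℝ] F)
    (w : Ext) : A w = w.1.1 • A ((1, 0, 0), (0, 0, 0))
    + w.1.2.1 • A ((0, 1, 0), (0, 0, 0)) + w.1.2.2 • A ((0, 0, 1), (0, 0, 0))
    + w.2.1 • A ((0, 0, 0), (1, 0, 0)) + w.2.2.1 • A ((0, 0, 0), (0, 1, 0))
    + w.2.2.2 • A ((0, 0, 0), (0, 0, 1)) := by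
  conv_lhs => rw [decompose w]
  simp only [map_add, map_smul]

/-- Since `F` is a function of `X` alone along every graph, its total `u`-derivative vanishes with
that of `X`, and this splits in `D₁`, `K₁`. If `X_t ≠ 0`, then `F_t = F' X_t` makes the slope `F'`
independent of `f₁`, whence `F_f = 0`; this contradicts the invertibility of the derivative of `φ`.
-/
theorem fderiv_F (h : IsEquivalence φ W) (hW : IsOpen W) (hz : z ∈ W) (hr : z ∈ regular) :
    (fderiv ℝ φ z ((1, 0, 0), (0, 0, 0))).1.2.1 = 0 ∧
    (fderiv ℝ φ z ((1, 0, 0), (0, 0, 0))).2.1 = 0 ∧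
    (fderiv ℝ φ z ((0, 0, 1), (0, 0, 0))).2.1 = 0 ∧
    (fderiv ℝ φ z ((0, 0, 0), (0, 1, 0))).2.1 = 0 ∧
    (fderiv ℝ φ z ((0, 0, 0), (0, 0, 1))).2.1 = 0 := by
  obtain ⟨T1, T2, T3, T4, T5, T6⟩ := h.fderiv_T hW hz hr
  obtain ⟨X2, X3, X4, X5, X6⟩ := h.fderiv_X_aux hW hz hr
  obtain ⟨_, _, _, rfl, rfl, rfl, -, -, -, -, F0, _, _, a1, a2, a3⟩ := h.first_order hW hz hr 0 0 0
  obtain ⟨_, _, _, rfl, rfl, rfl, -, -, -, -, F1, _, _, b1, b2, -⟩ := h.first_order hW hz hr 1 0 0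
  obtain ⟨_, _, _, rfl, rfl, rfl, -, -, -, -, _, _, _, -, -, c3⟩ := h.first_order hW hz hr 0 1 0
  obtain ⟨_, _, _, rfl, rfl, rfl, -, -, -, -, _, _, _, -, -, d3⟩ := h.first_order hW hz hr 0 0 1
  replace a1 := congrArg Prod.fst a1
  replace a2 := congrArg Prod.fst a2
  replace a3 := congrArg Prod.fst a3
  replace b1 := congrArg Prod.fst b1
  replace b2 := congrArg Prod.fst b2
  replace c3 := congrArg Prod.fst c3
  replace d3 := congrArg Prod.fst d3
  simp only [zero_smul, add_zero, one_smul, Prod.fst_add, Prod.snd_add, X3, X4, X5, X6, mul_zero]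
    at a1 a2 a3 b1 b2 c3 d3
  have F3 : (fderiv ℝ φ z ((0, 0, 0), (0, 1, 0))).2.1 = 0 := by linarith
  have F4 : (fderiv ℝ φ z ((0, 0, 0), (0, 0, 1))).2.1 = 0 := by linarith
  by_cases hX : (fderiv ℝ φ z ((1, 0, 0), (0, 0, 0))).1.2.1 = 0
  · exact ⟨hX, by rw [a1, hX, mul_zero], a3, F3, F4⟩
  · exfalso
    have hF : F0 = F1 := mul_right_cancel₀ hX (by rw [← a1, ← b1])
    have Ff : (fderiv ℝ φ z ((0, 0, 0), (1, 0, 0))).2.1 = 0 := by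
      rw [hF] at a2; linarith
    -- The `T`, `X` and `F` rows now involve only the `t` and `x` components of `w`. The first two
    -- rows annihilate these components, so the `F` entry cannot be `1`.
    obtain ⟨w, hw⟩ := (h.bijective_fderiv z hz).2 ((0, 0, 0), (1, 0, 0))
    rw [map_decompose] at hw
    have w1 := congrArg (fun y ↦ y.1.1) hw
    have w2 := congrArg (fun y ↦ y.1.2.1) hw
    have w3 := congrArg (fun y ↦ y.2.1) hw
    simp only [Prod.fst_add, Prod.snd_add, Prod.smul_fst, Prod.smul_snd, smul_eq_mul, T2, T3, T4,
      T5, T6, X3, X4, X5, X6, a3, F3, F4, Ff, mul_zero, add_zero] at w1 w2 w3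
    have w1' : w.1.1 = 0 := (mul_eq_zero.mp w1).resolve_right T1
    rw [w1', zero_mul, zero_add] at w2
    have w2' : w.1.2.1 = 0 := (mul_eq_zero.mp w2).resolve_right X2
    rw [w1', w2'] at w3
    simp at w3

/-- `ũ` does not depend on the values of `D` and `K`. -/
theorem fderiv_U_aux (h : IsEquivalence φ W) (hW : IsOpen W) (hz : z ∈ W) (hr : z ∈ regular) :
    (fderiv ℝ φ z ((0, 0, 1), (0, 0, 0))).1.2.2 ≠ 0 ∧
    (fderiv ℝ φ z ((0, 0, 0), (0, 1, 0))).1.2.2 = 0 ∧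
    (fderiv ℝ φ z ((0, 0, 0), (0, 0, 1))).1.2.2 = 0 := by
  obtain ⟨_, _, _, -, -, rfl, -, -, a1, -⟩ := h.first_order hW hz hr 0 0 0
  simp only [zero_smul, add_zero] at a1
  have hreg := h.transformed_ne_zero hW hz hr
  -- Only `r` and `k` vary, so only the second derivatives of `D` and `K` change; the relation is
  -- affine in them, with coefficients proportional to `U_D` and `U_K`.
  have e : ∀ r k : ℝ, _ := fun r k ↦ h.second_order hW hz hr 0 r 0 k rfl
  have lin : ∀ d k : ℝ, fderiv ℝ φ z (0, (0, d, k)) = d • fderiv ℝ φ z ((0, 0, 0), (0, 1, 0))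
      + k • fderiv ℝ φ z ((0, 0, 0), (0, 0, 1)) := by
    intro d k
    rw [map_decompose]
    simp
  simp only [testEquation_liftDeriv₂, lin] at e
  have e0 := e 0 0
  have e1 := e 1 0
  have e2 := e 0 1
  simp only [Prod.fst_add, Prod.snd_add, Prod.smul_fst, Prod.smul_snd, smul_eq_mul] at e0 e1 e2
  have k1 : (φ z).2.2.1 * z.2.2.1 * z.2.2.1
      * (fderiv ℝ φ z ((0, 0, 0), (0, 1, 0))).1.2.2 = 0 := by linarith
  have k2 : (φ z).2.2.1 * z.2.2.1 * (fderiv ℝ φ z ((0, 0, 0), (0, 0, 1))).1.2.2 = 0 := by linarith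
  exact ⟨a1, by simpa [hreg.2, hr.2] using k1, by simpa [hreg.2, hr.2] using k2⟩

theorem fderiv_fderiv_U (h : IsEquivalence φ W) (hW : IsOpen W) (hreg : W ⊆ regular) (hz : z ∈ W)
    (D₁ K₁ : ℝ) :
    (fderiv ℝ (fderiv ℝ φ) z ((0, 0, 1), (0, D₁, K₁)) ((0, 0, 1), (0, D₁, K₁))).1.2.2 =
      (fderiv ℝ (fderiv ℝ φ) z ((0, 0, 1), (0, 0, 0)) ((0, 0, 1), (0, 0, 0))).1.2.2 := by
  have hφ : ContDiffAt ℝ ∞ φ z := h.smooth.contDiffAt (hW.mem_nhds hz)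
  let L : Ext →L[ℝ] ℝ := (ContinuousLinearMap.snd ℝ ℝ ℝ).comp
    ((ContinuousLinearMap.snd ℝ ℝ (ℝ × ℝ)).comp (ContinuousLinearMap.fst ℝ Base (ℝ × ℝ × ℝ)))
  have hL : ∀ y, L y = y.1.2.2 := fun _ ↦ rfl
  have hev : ∀ᶠ q in 𝓝 z, q ∈ W := hW.mem_nhds hz
  have h1 : ∀ w, (fderiv ℝ (fderiv ℝ φ) z w ((0, 0, 0), (0, 1, 0))).1.2.2 = 0 := fun w ↦
    fderiv_fderiv_eq_zero hφ L (hev.mono fun q hq ↦ (h.fderiv_U_aux hW hq (hreg hq)).2.1) w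
  have h2 : ∀ w, (fderiv ℝ (fderiv ℝ φ) z w ((0, 0, 0), (0, 0, 1))).1.2.2 = 0 := fun w ↦
    fderiv_fderiv_eq_zero hφ L (hev.mono fun q hq ↦ (h.fderiv_U_aux hW hq (hreg hq)).2.2) w
  have k : ∀ w, (fderiv ℝ (fderiv ℝ φ) z w ((0, 0, 1), (0, D₁, K₁))).1.2.2 =
      (fderiv ℝ (fderiv ℝ φ) z w ((0, 0, 1), (0, 0, 0))).1.2.2 := by
    intro w
    rw [map_decompose]
    simp [h1, h2]
  rw [k, fderiv_fderiv_symm hφ, k]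

/-- With `U_D = U_K = 0`, the second-order relation reads `D (D̃_u + D₁ D̃_D + K₁ D̃_K) U_u = D̃ (D₁
U_u - D U_uu)`. The three claims are its coefficients of `K₁`, of `D₁` and its constant term. -/
theorem fderiv_D_aux (h : IsEquivalence φ W) (hW : IsOpen W) (hreg : W ⊆ regular) (hz : z ∈ W) :
    (fderiv ℝ φ z ((0, 0, 0), (0, 0, 1))).2.2.1 = 0 ∧
    z.2.2.1 * (fderiv ℝ φ z ((0, 0, 0), (0, 1, 0))).2.2.1 = (φ z).2.2.1 ∧
    (fderiv ℝ φ z ((0, 0, 1), (0, 0, 0))).2.2.1 * (fderiv ℝ φ z ((0, 0, 1), (0, 0, 0))).1.2.2 =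
      -(φ z).2.2.1 *
        (fderiv ℝ (fderiv ℝ φ) z ((0, 0, 1), (0, 0, 0)) ((0, 0, 1), (0, 0, 0))).1.2.2 := by
  have hr := hreg hz
  obtain ⟨U1, U2, U3⟩ := h.fderiv_U_aux hW hz hr
  have lin : ∀ d k : ℝ, fderiv ℝ φ z ((0, 0, 1), (0, d, k)) =
      fderiv ℝ φ z ((0, 0, 1), (0, 0, 0)) + d • fderiv ℝ φ z ((0, 0, 0), (0, 1, 0))
      + k • fderiv ℝ φ z ((0, 0, 0), (0, 0, 1)) := by
    intro d k
    rw [map_decompose]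
    simp
  have lin' : ∀ d k : ℝ, (fderiv ℝ φ z (0, (0, d, k))).1.2.2 = 0 := by
    intro d k
    rw [map_decompose]
    simp [U2, U3]
  have e : ∀ D₁ K₁ : ℝ, _ := fun D₁ K₁ ↦ 
    h.second_order hW hz hr D₁ 0 K₁ 0 (lin D₁ K₁).symm
  simp only [Prod.fst_add, Prod.snd_add, h.fderiv_fderiv_U hW hreg hz, Equation.liftDeriv₂,
    mul_zero, zero_pow two_ne_zero, lin', Prod.smul_fst, Prod.smul_snd, smul_eq_mul, U2, U3,
    add_zero] at e
  have e0 := e 0 0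
  have e1 := e 1 0
  have e2 := e 0 1
  simp only [zero_mul, one_mul, add_zero] at e0 e1 e2
  have hne : z.2.2.1 * (fderiv ℝ φ z ((0, 0, 1), (0, 0, 0))).1.2.2 ≠ 0 := mul_ne_zero hr.2 U1
  refine ⟨mul_left_cancel₀ hne ?_, mul_right_cancel₀ U1 ?_, mul_left_cancel₀ hr.2 ?_⟩ <;> linarith

/-- `ũ` depends on `u` only; the transformed `D` and `K` do not depend on `t`, `x` and `f`. -/
theorem fderiv_U (h : IsEquivalence φ W) (hW : IsOpen W) (hreg : W ⊆ regular) (hz : z ∈ W) :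
    ((fderiv ℝ φ z ((1, 0, 0), (0, 0, 0))).1.2.2 = 0 ∧
    (fderiv ℝ φ z ((0, 1, 0), (0, 0, 0))).1.2.2 = 0 ∧
    (fderiv ℝ φ z ((0, 0, 0), (1, 0, 0))).1.2.2 = 0) ∧
    (fderiv ℝ φ z ((1, 0, 0), (0, 0, 0))).2.2 = 0 ∧
    (fderiv ℝ φ z ((0, 1, 0), (0, 0, 0))).2.2 = 0 ∧
    (fderiv ℝ φ z ((0, 0, 0), (1, 0, 0))).2.2 = 0 := by
  have hr := hreg hz
  have hφr := h.transformed_ne_zero hW hz hr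
  obtain ⟨U1, U2, U3⟩ := h.fderiv_U_aux hW hz hr
  obtain ⟨D1, D2, -⟩ := h.fderiv_D_aux hW hreg hz
  have hDD : (fderiv ℝ φ z ((0, 0, 0), (0, 1, 0))).2.2.1 ≠ 0 := by
    intro h0; rw [h0, mul_zero] at D2; exact hφr.2 D2.symm
  have main : ∀ f₁ : ℝ, ((fderiv ℝ φ z ((1, 0, 0), (0, 0, 0))).1.2.2 = 0 ∧
      (fderiv ℝ φ z ((0, 1, 0), (0, 0, 0))).1.2.2
        + f₁ * (fderiv ℝ φ z ((0, 0, 0), (1, 0, 0))).1.2.2 = 0) ∧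
      (fderiv ℝ φ z ((1, 0, 0), (0, 0, 0))).2.2 = 0 ∧
      (fderiv ℝ φ z ((0, 1, 0), (0, 0, 0))).2.2
        + f₁ • (fderiv ℝ φ z ((0, 0, 0), (1, 0, 0))).2.2 = 0 := by
    intro f₁
    obtain ⟨_, _, _, rfl, rfl, rfl, -, -, -, -, _, d0, k0, a1, a2, a3⟩ :=
      h.first_order hW hz hr f₁ 0 0
    obtain ⟨_, _, _, rfl, rfl, rfl, -, -, -, -, _, d1, k1, b1, b2, b3⟩ :=
      h.first_order hW hz hr f₁ 1 0
    replace a1 := congrArg Prod.snd a1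
    replace a2 := congrArg Prod.snd a2
    replace a3 := congrArg (fun y ↦ y.2.1) a3
    replace b1 := congrArg Prod.snd b1
    replace b2 := congrArg Prod.snd b2
    replace b3 := congrArg (fun y ↦ y.2.1) b3
    simp only [zero_smul, add_zero, one_smul, Prod.fst_add, Prod.snd_add, Prod.smul_fst,
      Prod.smul_snd, smul_eq_mul, U2] at a1 a2 a3 b1 b2 b3
    -- The slope of `D̃` as a function of `U` changes with `D₁` because `D̃_D ≠ 0`, whereas the
    -- total derivatives along `t` and `x` do not see `D₁`. So `U` cannot vary in those directions,
    -- and then neither can `D̃`, `K̃`.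
    have hd : d0 ≠ d1 := by
      intro h0
      rw [← h0, a3] at b3
      exact hDD (by linarith)
    have t1 : (fderiv ℝ φ z ((1, 0, 0), (0, 0, 0))).1.2.2 = 0 := by
      have := congrArg Prod.fst (a1.symm.trans b1)
      by_contra hne
      exact hd (mul_right_cancel₀ hne this)
    have t2 : (fderiv ℝ φ z ((0, 1, 0), (0, 0, 0))).1.2.2
        + f₁ * (fderiv ℝ φ z ((0, 0, 0), (1, 0, 0))).1.2.2 = 0 := by
      have := congrArg Prod.fst (a2.symm.trans b2)
      by_contra hne
      exact hd (mul_right_cancel₀ hne this)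
    rw [t1] at a1
    rw [t2] at a2
    rw [mul_zero, mul_zero] at a1 a2
    exact ⟨⟨t1, t2⟩, a1, a2⟩
  obtain ⟨⟨m1, m2⟩, m3, m4⟩ := main 0
  obtain ⟨⟨-, n2⟩, -, n4⟩ := main 1
  simp only [zero_mul, one_mul, zero_smul, one_smul, add_zero] at m2 m4 n2 n4
  rw [m2, zero_add] at n2
  rw [m4, zero_add] at n4
  exact ⟨⟨m1, m2, n2⟩, m3, m4, n4⟩

theorem leading (h : IsEquivalence φ W) (hW : IsOpen W) (hz : z ∈ W) (hr : z ∈ regular) :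
    z.2.1 * (φ z).2.2.1 * (fderiv ℝ φ z ((1, 0, 0), (0, 0, 0))).1.1 =
      (φ z).2.1 * z.2.2.1 * (fderiv ℝ φ z ((0, 1, 0), (0, 0, 0))).1.2.1 ^ 2 := by
  obtain ⟨_, _, _, rfl, rfl, rfl, -, -, -, a, -⟩ := h.first_order hW hz hr 0 0 0
  simpa using a

/-- Comparison of the first-order coefficients, available now that `X_t` and the `x`-dependence of
`U` are excluded. One test equation suffices, as nothing has to be split. -/
theorem convection (h : IsEquivalence φ W) (hW : IsOpen W) (hreg : W ⊆ regular) (hz : z ∈ W) :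
    z.2.1 * (φ z).2.2.2 * (fderiv ℝ φ z ((1, 0, 0), (0, 0, 0))).1.1 =
      (φ z).2.1 * (z.2.2.1 *
        (fderiv ℝ (fderiv ℝ φ) z ((0, 1, 0), (0, 0, 0)) ((0, 1, 0), (0, 0, 0))).1.2.1
          + z.2.2.2 * (fderiv ℝ φ z ((0, 1, 0), (0, 0, 0))).1.2.1) := by
  have hr := hreg hz
  set θ := testEquation z hr 0 0 0 0 0 with hθ
  have hl : θ.lift z.1 = z := testEquation_lift hr 0 0 0 0 0
  have hdom : z.1 ∈ θ.dom := testEquation_mem_dom hr 0 0 0 0 0 z.1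
  have hlW : θ.lift z.1 ∈ W := by rw [hl]; exact hz
  obtain ⟨θ', hm⟩ := h.exists_mapsNear (θ := θ) (p := z.1) hW hdom hlW
  have hφ : ContDiffAt ℝ ∞ φ (θ.lift z.1) := h.smooth.contDiffAt (hW.mem_nhds hlW)
  have hd := fderiv_induced hφ hdom
  have hd2 := fderiv_fderiv_induced hW h.smooth hdom hlW (0, 1, 0)
  have hU : ∀ᶠ q in 𝓝 z.1, (fderiv ℝ (induced φ θ) q (0, 1, 0)).2.2 = 0 := by
    filter_upwards [eventually_lift_mem hW hdom hlW] with q hq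
    rw [fderiv_induced (h.smooth.contDiffAt (hW.mem_nhds hq.2)) hq.1, map_decompose]
    obtain ⟨⟨-, u2, u3⟩, -⟩ := h.fderiv_U hW hreg hq.2
    simp [Equation.liftDeriv, u2, u3]
  have hX : (fderiv ℝ (induced φ θ) z.1 (1, 0, 0)).2.1 = 0 := by
    rw [hd, hl, hθ, testEquation_liftDeriv]
    simpa using (h.fderiv_F hW hz hr).1
  have conv := hm.convection_relation hX hU
  have hzf : θ.f z.1.2.1 = z.2.1 := congrArg (fun z ↦ z.2.1) hl
  have hzD : θ.D z.1.2.2 = z.2.2.1 := congrArg (fun z ↦ z.2.2.1) hl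
  have hzK : θ.K z.1.2.2 = z.2.2.2 := congrArg (fun z ↦ z.2.2.2) hl
  rw [hzf, hzD, hzK, hd2, hd, hd, hl] at conv
  simp only [hθ, testEquation_liftDeriv, testEquation_liftDeriv₂] at conv
  have h0 : ((0, (0, 0, 0)) : Ext) = 0 := rfl
  simpa [h0] using conv

end IsEquivalence

/-! ### Integration: equivalence transformations are scalings -/

/-- The transformations that scale and shift `t`, `x`, `u` and scale the arbitrary elements
accordingly. -/
noncomputable def scaling (T X U a τ ξ υ : ℝ) (z : Ext) : Ext :=
  ((T * z.1.1 + τ, X * z.1.2.1 + ξ, U * z.1.2.2 + υ),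
    (a * T / X ^ 2 * z.2.1, a * z.2.2.1, a / X * z.2.2.2))

theorem exists_const_of_fderiv_basis {W : Set Ext} (hW : IsOpen W) (hc : IsPreconnected W)
    {g : Ext → ℝ} (hg : ∀ z ∈ W, DifferentiableAt ℝ g z)
    (h : ∀ z ∈ W, fderiv ℝ g z ((1, 0, 0), (0, 0, 0)) = 0 ∧
      fderiv ℝ g z ((0, 1, 0), (0, 0, 0)) = 0 ∧ fderiv ℝ g z ((0, 0, 1), (0, 0, 0)) = 0 ∧
      fderiv ℝ g z ((0, 0, 0), (1, 0, 0)) = 0 ∧ fderiv ℝ g z ((0, 0, 0), (0, 1, 0)) = 0 ∧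
      fderiv ℝ g z ((0, 0, 0), (0, 0, 1)) = 0) : ∃ c, ∀ z ∈ W, g z = c := by
  refine hW.exists_is_const_of_fderiv_eq_zero hc (fun z hz ↦ (hg z hz).differentiableWithinAt) ?_
  intro z hz
  obtain ⟨h1, h2, h3, h4, h5, h6⟩ := h z hz
  refine ContinuousLinearMap.ext fun w ↦ ?_
  rw [IsEquivalence.map_decompose]
  simp [h1, h2, h3, h4, h5, h6]

/-- The coordinate functions on the extended space, as continuous linear functionals. -/
noncomputable def coord : Fin 6 → Ext →L[ℝ] ℝ :=
  let b := ContinuousLinearMap.fst ℝ Base (ℝ × ℝ × ℝ)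
  let e := ContinuousLinearMap.snd ℝ Base (ℝ × ℝ × ℝ)
  let p₁ := ContinuousLinearMap.fst ℝ ℝ (ℝ × ℝ)
  let p₂ := (ContinuousLinearMap.fst ℝ ℝ ℝ).comp (ContinuousLinearMap.snd ℝ ℝ (ℝ × ℝ))
  let p₃ := (ContinuousLinearMap.snd ℝ ℝ ℝ).comp (ContinuousLinearMap.snd ℝ ℝ (ℝ × ℝ))
  ![p₁.comp b, p₂.comp b, p₃.comp b, p₁.comp e, p₂.comp e, p₃.comp e]

theorem coord_zero (z : Ext) : coord 0 z = z.1.1 := rfl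
theorem coord_one (z : Ext) : coord 1 z = z.1.2.1 := rfl
theorem coord_two (z : Ext) : coord 2 z = z.1.2.2 := rfl
theorem coord_three (z : Ext) : coord 3 z = z.2.1 := rfl
theorem coord_four (z : Ext) : coord 4 z = z.2.2.1 := rfl
theorem coord_five (z : Ext) : coord 5 z = z.2.2.2 := rfl

section

variable {φ : Ext → Ext} {z : Ext}

theorem hasFDerivAt_coord (hφ : ContDiffAt ℝ ∞ φ z) (i : Fin 6) :
    HasFDerivAt (fun y ↦ coord i (φ y)) ((coord i).comp (fderiv ℝ φ z)) z :=
  (coord i).hasFDerivAt.comp z (hφ.differentiableAt (by simp)).hasFDerivAt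

theorem contDiffAt_coord_fderiv (hφ : ContDiffAt ℝ ∞ φ z) (i : Fin 6) (w : Ext) :
    ContDiffAt ℝ ∞ (fun y ↦ coord i (fderiv ℝ φ y w)) z :=
  (coord i).contDiff.contDiffAt.comp z
    ((hφ.fderiv_right (m := ∞) (by simp)).clm_apply contDiffAt_const)

theorem fderiv_coord_fderiv (hφ : ContDiffAt ℝ ∞ φ z) (i : Fin 6) (w w' : Ext) :
    fderiv ℝ (fun y ↦ coord i (fderiv ℝ φ y w)) z w' =
      coord i (fderiv ℝ (fderiv ℝ φ) z w' w) := by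
  have hd : DifferentiableAt ℝ (fun q ↦ fderiv ℝ φ q w) z :=
    ((hφ.fderiv_right (m := ∞) (by simp)).differentiableAt (by simp)).clm_apply
      (differentiableAt_const _)
  have h1 : fderiv ℝ (fun q ↦ coord i (fderiv ℝ φ q w)) z = _ :=
    ((coord i).hasFDerivAt.comp z hd.hasFDerivAt).fderiv
  rw [h1, ← fderiv_fderiv_apply hφ]
  rfl

end

namespace IsEquivalence

variable {φ : Ext → Ext} {W : Set Ext}

theorem contDiffAt (h : IsEquivalence φ W) (hW : IsOpen W) {z : Ext} (hz : z ∈ W) :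
    ContDiffAt ℝ ∞ φ z := h.smooth.contDiffAt (hW.mem_nhds hz)

/-- By symmetry of second derivatives: a component independent of the direction `w` has all its
partial derivatives independent of `w`. -/
theorem coord_second_eq_zero (h : IsEquivalence φ W) (hW : IsOpen W) (i : Fin 6) (w : Ext) {w' : Ext}
    (hw : ∀ z ∈ W, coord i (fderiv ℝ φ z w) = 0) {z : Ext} (hz : z ∈ W) :
    fderiv ℝ (fun y ↦ coord i (fderiv ℝ φ y w')) z w = 0 := by
  have hφ := h.contDiffAt hW hz
  rw [fderiv_coord_fderiv hφ, fderiv_fderiv_symm hφ]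
  have hev : ∀ᶠ q in 𝓝 z, q ∈ W := hW.mem_nhds hz
  exact fderiv_fderiv_eq_zero hφ (coord i) (hev.mono hw) w'

/-- Derivative of the relation between the leading coefficients. -/
theorem leading_deriv (h : IsEquivalence φ W) (hW : IsOpen W) (hreg : W ⊆ regular) {z : Ext}
    (hz : z ∈ W) (w : Ext) (hwf : w.2.1 = 0) (hwD : w.2.2.1 = 0)
    (hF : (fderiv ℝ φ z w).2.1 = 0)
    (hX : fderiv ℝ (fun y ↦ coord 1 (fderiv ℝ φ y ((0, 1, 0), (0, 0, 0)))) z w = 0) :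
    (fderiv ℝ φ z w).2.2.1 * (fderiv ℝ φ z ((1, 0, 0), (0, 0, 0))).1.1
      + (φ z).2.2.1 * fderiv ℝ (fun y ↦ coord 0 (fderiv ℝ φ y ((1, 0, 0), (0, 0, 0)))) z w
        = 0 := by
  have hφ := h.contDiffAt hW hz
  have hT := ((contDiffAt_coord_fderiv hφ 0 ((1, 0, 0), (0, 0, 0))).differentiableAt
    (by simp)).hasFDerivAt
  have hXx := ((contDiffAt_coord_fderiv hφ 1 ((0, 1, 0), (0, 0, 0))).differentiableAt
    (by simp)).hasFDerivAt
  have h1 := (((coord 3).hasFDerivAt (x := z)).mul (hasFDerivAt_coord hφ 4)).mul hT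
  have h2 := ((hasFDerivAt_coord hφ 3).mul ((coord 4).hasFDerivAt (x := z))).mul (hXx.pow 2)
  have hev : ∀ᶠ q in 𝓝 z, q ∈ W := hW.mem_nhds hz
  have h3 := h1.unique (h2.congr_of_eventuallyEq
    (hev.mono fun q hq ↦ h.leading hW hq (hreg hq)))
  have h4 := congrArg (fun A ↦ A w) h3
  simp only [add_apply, smul_apply, ContinuousLinearMap.comp_apply,
    coord_three, coord_four, hF, hX, hwf, hwD, smul_eq_mul, mul_zero, add_zero, Pi.mul_apply] at h4
  have h5 : z.2.1 * ((fderiv ℝ φ z w).2.2.1 * (fderiv ℝ φ z ((1, 0, 0), (0, 0, 0))).1.1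
      + (φ z).2.2.1 * fderiv ℝ (fun y ↦ coord 0 (fderiv ℝ φ y ((1, 0, 0), (0, 0, 0)))) z w)
        = 0 := by
    rw [coord_zero] at h4
    linear_combination h4
  exact (mul_eq_zero.mp h5).resolve_left (hreg hz).1

/-- Only `T_tt` needs an argument: in the `t`-derivative of `f D̃ T_t = F D X_x²` all other factors
are constant, leaving `D̃ T_tt = 0`. -/
theorem exists_time_const (h : IsEquivalence φ W) (hW : IsOpen W) (hc : IsPreconnected W)
    (hreg : W ⊆ regular) :
    ∃ T, ∀ z ∈ W, (fderiv ℝ φ z ((1, 0, 0), (0, 0, 0))).1.1 = T := by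
  refine exists_const_of_fderiv_basis hW hc
    (g := fun y ↦ coord 0 (fderiv ℝ φ y ((1, 0, 0), (0, 0, 0))))
    (fun z hz ↦ (contDiffAt_coord_fderiv (h.contDiffAt hW hz) 0 _).differentiableAt (by simp)) ?_
  intro z hz
  refine ⟨?_, ?_, ?_, ?_, ?_, ?_⟩
  · have := h.leading_deriv hW hreg hz ((1, 0, 0), (0, 0, 0)) rfl rfl
      (h.fderiv_F hW hz (hreg hz)).2.1 (h.coord_second_eq_zero hW 1 ((1, 0, 0), (0, 0, 0))
        (fun z hz ↦ (h.fderiv_F hW hz (hreg hz)).1) hz)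
    have hD : (fderiv ℝ φ z ((1, 0, 0), (0, 0, 0))).2.2.1 = 0 := by
      rw [(h.fderiv_U hW hreg hz).2.1]; rfl
    rw [hD, zero_mul, zero_add] at this
    exact (mul_eq_zero.mp this).resolve_left (h.transformed_ne_zero hW hz (hreg hz)).2
  · exact h.coord_second_eq_zero hW 0 ((0, 1, 0), (0, 0, 0))
        (fun z hz ↦ (h.fderiv_T hW hz (hreg hz)).2.1) hz
  · exact h.coord_second_eq_zero hW 0 ((0, 0, 1), (0, 0, 0))
        (fun z hz ↦ (h.fderiv_T hW hz (hreg hz)).2.2.1) hz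
  · exact h.coord_second_eq_zero hW 0 ((0, 0, 0), (1, 0, 0))
        (fun z hz ↦ (h.fderiv_T hW hz (hreg hz)).2.2.2.1) hz
  · exact h.coord_second_eq_zero hW 0 ((0, 0, 0), (0, 1, 0))
        (fun z hz ↦ (h.fderiv_T hW hz (hreg hz)).2.2.2.2.1) hz
  · exact h.coord_second_eq_zero hW 0 ((0, 0, 0), (0, 0, 1))
        (fun z hz ↦ (h.fderiv_T hW hz (hreg hz)).2.2.2.2.2) hz

/-- The `u`-derivative of the leading relation: `f`, `D`, `F`, `X_x` and `T_t` do not vary with `u`.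
-/
theorem fderiv_D_u (h : IsEquivalence φ W) (hW : IsOpen W) (hreg : W ⊆ regular) {z : Ext}
    (hz : z ∈ W) : (fderiv ℝ φ z ((0, 0, 1), (0, 0, 0))).2.2.1 = 0 := by
  have := h.leading_deriv hW hreg hz ((0, 0, 1), (0, 0, 0)) rfl rfl
      (h.fderiv_F hW hz (hreg hz)).2.2.1 (h.coord_second_eq_zero hW 1 ((0, 0, 1), (0, 0, 0))
        (fun z hz ↦ (h.fderiv_X_aux hW hz (hreg hz)).2.1) hz)
  have hTu : fderiv ℝ (fun y ↦ coord 0 (fderiv ℝ φ y ((1, 0, 0), (0, 0, 0)))) z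
      ((0, 0, 1), (0, 0, 0)) = 0 :=
    h.coord_second_eq_zero hW 0 ((0, 0, 1), (0, 0, 0))
        (fun z hz ↦ (h.fderiv_T hW hz (hreg hz)).2.2.1) hz
  rw [hTu, mul_zero, add_zero] at this
  exact (mul_eq_zero.mp this).resolve_right (h.fderiv_T hW hz (hreg hz)).1

/-- The critical derivative is `U_uu`, which vanishes because `D̃_u U_u = -D̃ U_uu` and `D̃_u = 0`.
-/
theorem exists_u_const (h : IsEquivalence φ W) (hW : IsOpen W) (hc : IsPreconnected W)
    (hreg : W ⊆ regular) :
    ∃ U, ∀ z ∈ W, (fderiv ℝ φ z ((0, 0, 1), (0, 0, 0))).1.2.2 = U := by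
  refine exists_const_of_fderiv_basis hW hc
    (g := fun y ↦ coord 2 (fderiv ℝ φ y ((0, 0, 1), (0, 0, 0))))
    (fun z hz ↦ (contDiffAt_coord_fderiv (h.contDiffAt hW hz) 2 _).differentiableAt (by simp)) ?_
  intro z hz
  refine ⟨?_, ?_, ?_, ?_, ?_, ?_⟩
  · exact h.coord_second_eq_zero hW 2 ((1, 0, 0), (0, 0, 0))
        (fun z hz ↦ (h.fderiv_U hW hreg hz).1.1) hz
  · exact h.coord_second_eq_zero hW 2 ((0, 1, 0), (0, 0, 0))
        (fun z hz ↦ (h.fderiv_U hW hreg hz).1.2.1) hz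
  · have h1 := (h.fderiv_D_aux hW hreg hz).2.2
    rw [h.fderiv_D_u hW hreg hz, zero_mul] at h1
    rw [fderiv_coord_fderiv (h.contDiffAt hW hz)]
    exact (mul_eq_zero.mp h1.symm).resolve_left
      (neg_ne_zero.mpr (h.transformed_ne_zero hW hz (hreg hz)).2)
  · exact h.coord_second_eq_zero hW 2 ((0, 0, 0), (1, 0, 0))
        (fun z hz ↦ (h.fderiv_U hW hreg hz).1.2.2) hz
  · exact h.coord_second_eq_zero hW 2 ((0, 0, 0), (0, 1, 0))
        (fun z hz ↦ (h.fderiv_U_aux hW hz (hreg hz)).2.1) hz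
  · exact h.coord_second_eq_zero hW 2 ((0, 0, 0), (0, 0, 1))
        (fun z hz ↦ (h.fderiv_U_aux hW hz (hreg hz)).2.2) hz

/-- `D̃` varies with `D` only and satisfies `D D̃_D = D̃`, so `D̃ / D` has zero gradient. -/
theorem exists_D_const (h : IsEquivalence φ W) (hW : IsOpen W) (hc : IsPreconnected W)
    (hreg : W ⊆ regular) : ∃ a, ∀ z ∈ W, (φ z).2.2.1 = a * z.2.2.1 := by
  have hder : ∀ z ∈ W, HasFDerivAt (fun y ↦ coord 4 (φ y) * (coord 4 y)⁻¹) _ z := fun z hz ↦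
    (hasFDerivAt_coord (h.contDiffAt hW hz) 4).mul
      ((hasDerivAt_inv (hreg hz).2).comp_hasFDerivAt z ((coord 4).hasFDerivAt (x := z)))
  obtain ⟨a, ha⟩ := exists_const_of_fderiv_basis hW hc
    (g := fun y ↦ coord 4 (φ y) * (coord 4 y)⁻¹) (fun z hz ↦ (hder z hz).differentiableAt) (by
      intro z hz
      rw [(hder z hz).fderiv]
      obtain ⟨d1, d2, -⟩ := h.fderiv_D_aux hW hreg hz
      obtain ⟨-, d3, d4, d5⟩ := h.fderiv_U hW hreg hz
      have d6 := h.fderiv_D_u hW hreg hz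
      have hD := (hreg hz).2
      simp [coord_four, d1, d3, d4, d5, d6, ← d2]
      field_simp
      simp)
  refine ⟨a, fun z hz ↦ ?_⟩
  have := ha z hz
  simp only [coord_four] at this
  rw [← this, mul_assoc, inv_mul_cancel₀ (hreg hz).2, mul_one]

/-- Eliminating `F` between the leading and convection relations gives `X_x² K̃ = a (D X_xx + K
X_x)`. As `X` does not depend on `K`, the `K`-derivative yields `X_x K̃_K = a`. But `K̃` does not
depend on `x`, so the `x`-derivative of this gives `X_xx K̃_K = 0`, and `K̃_K ≠ 0` because `a ≠ 0`.
-/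
theorem exists_space_const (h : IsEquivalence φ W) (hW : IsOpen W) (hc : IsPreconnected W)
    (hreg : W ⊆ regular) :
    ∃ X, ∀ z ∈ W, (fderiv ℝ φ z ((0, 1, 0), (0, 0, 0))).1.2.1 = X ∧
      (fderiv ℝ (fderiv ℝ φ) z ((0, 1, 0), (0, 0, 0)) ((0, 1, 0), (0, 0, 0))).1.2.1 = 0 := by
  obtain ⟨a, ha⟩ := h.exists_D_const hW hc hreg
  set g : Ext → ℝ := fun y ↦ coord 1 (fderiv ℝ φ y ((0, 1, 0), (0, 0, 0))) with hg
  set k : Ext → ℝ := fun y ↦ coord 5 (fderiv ℝ φ y ((0, 0, 0), (0, 0, 1))) with hk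
  have hgs : ∀ z ∈ W, ContDiffAt ℝ ∞ g z := fun z hz ↦
    contDiffAt_coord_fderiv (h.contDiffAt hW hz) 1 _
  have hks : ∀ z ∈ W, ContDiffAt ℝ ∞ k z := fun z hz ↦
    contDiffAt_coord_fderiv (h.contDiffAt hW hz) 5 _
  have hgne : ∀ z ∈ W, g z ≠ 0 := fun z hz ↦ (h.fderiv_X_aux hW hz (hreg hz)).1
  have gK : ∀ z ∈ W, fderiv ℝ g z ((0, 0, 0), (0, 0, 1)) = 0 := fun z hz ↦
    h.coord_second_eq_zero hW 1 ((0, 0, 0), (0, 0, 1))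
        (fun z hz ↦ (h.fderiv_X_aux hW hz (hreg hz)).2.2.2.2) hz
  have kx : ∀ z ∈ W, fderiv ℝ k z ((0, 1, 0), (0, 0, 0)) = 0 := fun z hz ↦
    h.coord_second_eq_zero hW 5 ((0, 1, 0), (0, 0, 0))
      (fun z hz ↦ congrArg Prod.snd (h.fderiv_U hW hreg hz).2.2.1) hz
  have hane : ∀ z ∈ W, a ≠ 0 := by
    intro z hz h0
    have := (h.transformed_ne_zero hW hz (hreg hz)).2
    rw [ha z hz, h0, zero_mul] at this
    exact this rfl
  have gx : ∀ z ∈ W, (fderiv ℝ (fderiv ℝ φ) z ((0, 1, 0), (0, 0, 0)) ((0, 1, 0), (0, 0, 0))).1.2.1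
      = fderiv ℝ g z ((0, 1, 0), (0, 0, 0)) := fun z hz ↦
    (fderiv_coord_fderiv (h.contDiffAt hW hz) 1 _ _).symm
  have rel : ∀ z ∈ W, g z ^ 2 * (φ z).2.2.2 =
      a * (z.2.2.1 * fderiv ℝ g z ((0, 1, 0), (0, 0, 0)) + z.2.2.2 * g z) := by
    intro z hz
    have e1 := h.leading hW hz (hreg hz)
    have e2 := h.convection hW hreg hz
    rw [gx z hz] at e2
    rw [ha z hz] at e1
    have hgz : (fderiv ℝ φ z ((0, 1, 0), (0, 0, 0))).1.2.1 = g z := rfl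
    rw [hgz] at e1 e2
    have hne : (φ z).2.1 * z.2.2.1 ≠ 0 :=
      mul_ne_zero (h.transformed_ne_zero hW hz (hreg hz)).1 (hreg hz).2
    apply mul_left_cancel₀ hne
    linear_combination a * z.2.2.1 * e2 - (φ z).2.2.2 * e1
  have rel2 : ∀ z ∈ W, g z * k z = a := by
    intro z hz
    have hφ := h.contDiffAt hW hz
    have hgd := ((hgs z hz).differentiableAt (by simp)).hasFDerivAt
    have hgxd : HasFDerivAt (fun y ↦ fderiv ℝ g y ((0, 1, 0), (0, 0, 0))) _ z :=
      ((((hgs z hz).fderiv_right (m := ∞) (by simp)).differentiableAt (by simp)).clm_apply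
        (differentiableAt_const _)).hasFDerivAt
    have hgxK : fderiv ℝ (fun y ↦ fderiv ℝ g y ((0, 1, 0), (0, 0, 0))) z ((0, 0, 0), (0, 0, 1))
        = 0 := by
      rw [fderiv_fderiv_apply (hgs z hz), fderiv_fderiv_symm (hgs z hz)]
      have hev : ∀ᶠ q in 𝓝 z, q ∈ W := hW.mem_nhds hz
      exact fderiv_fderiv_eq_zero (hgs z hz) (ContinuousLinearMap.id ℝ ℝ) (hev.mono gK) _
    have h1 := (hgd.pow 2).mul (hasFDerivAt_coord hφ 5)
    have h2 := ((((coord 4).hasFDerivAt (x := z)).mul hgxd).add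
      (((coord 5).hasFDerivAt (x := z)).mul hgd)).const_mul a
    have hev : ∀ᶠ q in 𝓝 z, q ∈ W := hW.mem_nhds hz
    have h3 := h1.unique (h2.congr_of_eventuallyEq (hev.mono fun q hq ↦ rel q hq))
    have h4 := congrArg (fun A ↦ A ((0, 0, 0), (0, 0, 1))) h3
    simp only [add_apply, smul_apply, ContinuousLinearMap.comp_apply, gK z hz, hgxK, smul_eq_mul,
      coord_four, mul_zero, add_zero, zero_add, coord_five, mul_one] at h4
    apply mul_left_cancel₀ (hgne z hz)
    have h5 : k z = (fderiv ℝ φ z ((0, 0, 0), (0, 0, 1))).2.2.2 := rfl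
    rw [h5]
    linear_combination h4
  have gxx : ∀ z ∈ W, fderiv ℝ g z ((0, 1, 0), (0, 0, 0)) = 0 := by
    intro z hz
    have h1 := (((hgs z hz).differentiableAt (by simp)).hasFDerivAt).mul
      ((hks z hz).differentiableAt (by simp)).hasFDerivAt
    have hev : ∀ᶠ q in 𝓝 z, q ∈ W := hW.mem_nhds hz
    have h3 := h1.unique ((hasFDerivAt_const a z).congr_of_eventuallyEq
      (hev.mono fun q hq ↦ rel2 q hq))
    have h4 := congrArg (fun A ↦ A ((0, 1, 0), (0, 0, 0))) h3
    simp only [add_apply, smul_apply, kx z hz, smul_eq_mul, mul_zero, zero_add, zero_apply] at h4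
    refine (mul_eq_zero.mp h4).resolve_left ?_
    intro h0
    apply hane z hz
    rw [← rel2 z hz, h0, mul_zero]
  obtain ⟨X, hX⟩ := exists_const_of_fderiv_basis hW hc (g := g)
    (fun z hz ↦ (hgs z hz).differentiableAt (by simp)) (fun z hz ↦ ⟨
      h.coord_second_eq_zero hW 1 ((1, 0, 0), (0, 0, 0))
        (fun z hz ↦ (h.fderiv_F hW hz (hreg hz)).1) hz,
      gxx z hz,
      h.coord_second_eq_zero hW 1 ((0, 0, 1), (0, 0, 0))
        (fun z hz ↦ (h.fderiv_X_aux hW hz (hreg hz)).2.1) hz,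
      h.coord_second_eq_zero hW 1 ((0, 0, 0), (1, 0, 0))
        (fun z hz ↦ (h.fderiv_X_aux hW hz (hreg hz)).2.2.1) hz,
      h.coord_second_eq_zero hW 1 ((0, 0, 0), (0, 1, 0))
        (fun z hz ↦ (h.fderiv_X_aux hW hz (hreg hz)).2.2.2.1) hz,
      gK z hz⟩)
  exact ⟨X, fun z hz ↦ ⟨hX z hz, (gx z hz).trans (gxx z hz)⟩⟩

/-- A coordinate whose gradient is a constant multiple of a coordinate direction is affine. -/
theorem exists_affine_coord (h : IsEquivalence φ W) (hW : IsOpen W) (hc : IsPreconnected W)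
    (i : Fin 6) (c : ℝ)
    (hd : ∀ z ∈ W, ∀ w, coord i (fderiv ℝ φ z w) = c * coord i w) :
    ∃ s, ∀ z ∈ W, coord i (φ z) = c * coord i z + s := by
  have hder : ∀ z ∈ W, HasFDerivAt (fun y ↦ coord i (φ y) - c * coord i y) _ z := fun z hz ↦
    (hasFDerivAt_coord (h.contDiffAt hW hz) i).sub (((coord i).hasFDerivAt (x := z)).const_mul c)
  obtain ⟨s, hs⟩ := hW.exists_is_const_of_fderiv_eq_zero hc
    (fun z hz ↦ (hder z hz).differentiableAt.differentiableWithinAt) (by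
      intro z hz
      rw [(hder z hz).fderiv]
      refine ContinuousLinearMap.ext fun w ↦ ?_
      simp [hd z hz])
  exact ⟨s, fun z hz ↦ by rw [← hs z hz]; ring⟩

/-- Equivalence transformations on a connected open set are scalings. -/
theorem exists_scaling (h : IsEquivalence φ W) (hW : IsOpen W) (hc : IsConnected W)
    (hreg : W ⊆ regular) : ∃ T X U a τ ξ υ : ℝ, T ≠ 0 ∧ X ≠ 0 ∧ U ≠ 0 ∧ a ≠ 0 ∧
      Set.EqOn φ (scaling T X U a τ ξ υ) W := by
  have hc' := hc.isPreconnected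
  obtain ⟨T, hT⟩ := h.exists_time_const hW hc' hreg
  obtain ⟨X, hX⟩ := h.exists_space_const hW hc' hreg
  obtain ⟨U, hU⟩ := h.exists_u_const hW hc' hreg
  obtain ⟨a, ha⟩ := h.exists_D_const hW hc' hreg
  obtain ⟨z₀, hz₀⟩ := hc.nonempty
  have hT0 : T ≠ 0 := hT z₀ hz₀ ▸ (h.fderiv_T hW hz₀ (hreg hz₀)).1
  have hX0 : X ≠ 0 := (hX z₀ hz₀).1 ▸ (h.fderiv_X_aux hW hz₀ (hreg hz₀)).1
  have hU0 : U ≠ 0 := hU z₀ hz₀ ▸ (h.fderiv_U_aux hW hz₀ (hreg hz₀)).1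
  have ha0 : a ≠ 0 := by
    intro h0
    have := (h.transformed_ne_zero hW hz₀ (hreg hz₀)).2
    rw [ha z₀ hz₀, h0, zero_mul] at this
    exact this rfl
  obtain ⟨τ, hτ⟩ := h.exists_affine_coord hW hc' 0 T (by
    intro z hz w
    obtain ⟨-, T2, T3, T4, T5, T6⟩ := h.fderiv_T hW hz (hreg hz)
    rw [map_decompose (fderiv ℝ φ z) w]
    simp only [coord_zero]
    simp [hT z hz, T2, T3, T4, T5, T6, mul_comm])
  obtain ⟨ξ, hξ⟩ := h.exists_affine_coord hW hc' 1 X (by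
    intro z hz w
    obtain ⟨-, X2, X3, X4, X5⟩ := h.fderiv_X_aux hW hz (hreg hz)
    rw [map_decompose (fderiv ℝ φ z) w]
    simp only [coord_one]
    simp [(hX z hz).1, (h.fderiv_F hW hz (hreg hz)).1, X2, X3, X4, X5, mul_comm])
  obtain ⟨υ, hυ⟩ := h.exists_affine_coord hW hc' 2 U (by
    intro z hz w
    obtain ⟨-, U2, U3⟩ := h.fderiv_U_aux hW hz (hreg hz)
    obtain ⟨⟨U4, U5, U6⟩, -⟩ := h.fderiv_U hW hreg hz
    rw [map_decompose (fderiv ℝ φ z) w]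
    simp only [coord_two]
    simp [hU z hz, U2, U3, U4, U5, U6, mul_comm])
  refine ⟨T, X, U, a, τ, ξ, υ, hT0, hX0, hU0, ha0, fun z hz ↦ ?_⟩
  have e1 := h.leading hW hz (hreg hz)
  have e2 := h.convection hW hreg hz
  rw [hT z hz, (hX z hz).1, ha z hz] at e1
  rw [hT z hz, (hX z hz).1, (hX z hz).2, mul_zero, zero_add] at e2
  have hD := (hreg hz).2
  have hf := (hreg hz).1
  -- `F` and `K̃` need no integration: the leading and convection relations determine them
  -- algebraically.
  have F : (φ z).2.1 = a * T / X ^ 2 * z.2.1 := by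
    field_simp
    apply mul_right_cancel₀ hD
    linear_combination -e1
  have K : (φ z).2.2.2 = a / X * z.2.2.2 := by
    rw [F] at e2
    field_simp at e2 ⊢
    linear_combination e2
  exact Prod.ext (Prod.ext (hτ z hz) (Prod.ext (hξ z hz) (hυ z hz)))
    (Prod.ext F (Prod.ext (ha z hz) K))

end IsEquivalence

/-! ### Scalings are equivalence transformations -/

theorem MapsEquationAt.congr {φ φ' : Ext → Ext} {θ θ' : Equation} {q : Base}
    (h : MapsEquationAt φ θ θ' q) (hq : q ∈ θ.dom) (he : φ' =ᶠ[𝓝 (θ.lift q)] φ) :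
    MapsEquationAt φ' θ θ' q := by
  have hind : induced φ' θ =ᶠ[𝓝 q] induced φ θ := by
    filter_upwards [(Equation.contDiffAt_lift hq).continuousAt.eventually he] with y hy
    simp [induced, hy]
  have hq' := hind.self_of_nhds
  refine ⟨?_, ?_, ?_, ?_⟩
  · rw [hind.fderiv_eq]; exact h.nonsingular
  · rw [hq']; exact h.mem_dom
  · rw [hq', he.self_of_nhds]; exact h.map_lift
  · intro v v' hv0 hv hv' hvv
    rw [hq'] at hv' ⊢
    refine h.holds_iff v v' hv0 hv hv' ?_
    have hc : Filter.Tendsto (fun s : ℝ × ℝ ↦ (s.1, s.2, v s)) (𝓝 (q.1, q.2.1)) (𝓝 q) := by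
      have : ContinuousAt (fun s : ℝ × ℝ ↦ (s.1, s.2, v s)) (q.1, q.2.1) :=
        continuousAt_fst.prodMk (continuousAt_snd.prodMk hv.continuousAt)
      have h2 := this.tendsto
      simp only [hv0] at h2
      exact h2
    filter_upwards [hvv, hc.eventually hind] with s h1 h2
    rw [h2] at h1
    exact h1

theorem IsEquivalence.congr {φ φ' : Ext → Ext} {W : Set Ext} (h : IsEquivalence φ W)
    (hW : IsOpen W) (he : Set.EqOn φ' φ W) : IsEquivalence φ' W where
  smooth := h.smooth.congr he
  injOn := h.injOn.congr he.symm
  bijective_fderiv z hz := by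
    rw [(he.eventuallyEq_of_mem (hW.mem_nhds hz)).fderiv_eq]
    exact h.bijective_fderiv z hz
  maps_class θ p hp hpW := by
    obtain ⟨θ', hθ'⟩ := h.maps_class θ p hp hpW
    refine ⟨θ', ?_⟩
    filter_upwards [hθ', eventually_lift_mem hW hp hpW] with q h1 h2
    exact h1.congr h2.1 (he.eventuallyEq_of_mem (hW.mem_nhds h2.2))

theorem IsEquivalence.mono {φ : Ext → Ext} {V W : Set Ext} (h : IsEquivalence φ W) (hV : V ⊆ W) :
    IsEquivalence φ V where
  smooth := h.smooth.mono hV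
  injOn := h.injOn.mono hV
  bijective_fderiv z hz := h.bijective_fderiv z (hV hz)
  maps_class θ p hp hpW := h.maps_class θ p hp (hV hpW)

section scaling

variable {T X U a τ ξ υ : ℝ}

theorem hasDerivAt_comp_affine {g : ℝ → ℝ} {g' x c d y : ℝ} (hc : c ≠ 0) (hg : HasDerivAt g g' x)
    (hy : y = c * x + d) : HasDerivAt (fun y ↦ g ((y - d) / c)) (g' / c) y := by
  have h1 : HasDerivAt (fun y : ℝ ↦ (y - d) / c) (1 / c) y :=
    ((hasDerivAt_id y).sub_const d).div_const c
  have h2 : (y - d) / c = x := by rw [hy]; field_simp; ring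
  have h3 : HasDerivAt g g' ((fun y : ℝ ↦ (y - d) / c) y) := by simpa only [h2] using hg
  exact HasDerivAt.congr_deriv (h3.comp y h1) (by ring)

theorem isPreconnected_preimage_affine {c d : ℝ} (hc : c ≠ 0) {I : Set ℝ} (hI : IsPreconnected I) :
    IsPreconnected ((fun y ↦ (y - d) / c) ⁻¹' I) := by
  have : (fun x ↦ c * x + d) '' I = (fun y ↦ (y - d) / c) ⁻¹' I := by
    apply congrFun
    exact Set.image_eq_preimage_of_inverse (fun x ↦ by field_simp; ring)
      (fun y ↦ by field_simp; ring)
  rw [← this]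
  exact hI.image _ (by fun_prop)

/-- The image of an equation under a scaling. -/
noncomputable def Equation.scale (θ : Equation) (hT : T ≠ 0) (hX : X ≠ 0) (hU : U ≠ 0) (ha : a ≠ 0)
    (ξ υ : ℝ) : Equation where
  I := (fun x ↦ (x - ξ) / X) ⁻¹' θ.I
  J := (fun u ↦ (u - υ) / U) ⁻¹' θ.J
  f x := a * T / X ^ 2 * θ.f ((x - ξ) / X)
  D u := a * θ.D ((u - υ) / U)
  K u := a / X * θ.K ((u - υ) / U)
  isOpen_I := θ.isOpen_I.preimage (by fun_prop)
  isOpen_J := θ.isOpen_J.preimage (by fun_prop)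
  isPreconnected_I := isPreconnected_preimage_affine hX θ.isPreconnected_I
  isPreconnected_J := isPreconnected_preimage_affine hU θ.isPreconnected_J
  smooth_f := contDiffOn_const.mul
    (θ.smooth_f.comp (t := θ.I) (by fun_prop) (fun _ hx ↦ hx))
  smooth_D := contDiffOn_const.mul
    (θ.smooth_D.comp (t := θ.J) (by fun_prop) (fun _ hx ↦ hx))
  smooth_K := contDiffOn_const.mul
    (θ.smooth_K.comp (t := θ.J) (by fun_prop) (fun _ hx ↦ hx))
  f_ne_zero x hx := mul_ne_zero (by positivity) (θ.f_ne_zero _ hx)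
  D_ne_zero u hu := mul_ne_zero ha (θ.D_ne_zero _ hu)
  nonlinear := by
    obtain ⟨u, hu, h⟩ := θ.nonlinear
    have hD := ((θ.smooth_D.contDiffAt (θ.isOpen_J.mem_nhds hu)).differentiableAt
      (by simp)).hasDerivAt
    have hK := ((θ.smooth_K.contDiffAt (θ.isOpen_J.mem_nhds hu)).differentiableAt
      (by simp)).hasDerivAt
    have e : (U * u + υ - υ) / U = u := by field_simp; ring
    refine ⟨U * u + υ, by simpa only [Set.mem_preimage, e] using hu, ?_⟩
    rw [((hasDerivAt_comp_affine hU hD (d := υ) rfl).const_mul a).deriv,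
      ((hasDerivAt_comp_affine hU hK (d := υ) rfl).const_mul (a / X)).deriv]
    simpa [ha, hX, hU] using h

theorem contDiff_scaling : ContDiff ℝ ∞ (scaling T X U a τ ξ υ) := by
  unfold scaling
  fun_prop

theorem fderiv_scaling (z w : Ext) : fderiv ℝ (scaling T X U a τ ξ υ) z w =
    scaling T X U a 0 0 0 w := by
  have hc : ∀ i, HasFDerivAt (fun y ↦ coord i y) (coord i) z := fun i ↦ (coord i).hasFDerivAt
  have h : HasFDerivAt (scaling T X U a τ ξ υ) _ z :=
    ((((hc 0).const_mul T).add_const τ).prodMk ((((hc 1).const_mul X).add_const ξ).prodMk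
      (((hc 2).const_mul U).add_const υ))).prodMk
      (((hc 3).const_mul (a * T / X ^ 2)).prodMk (((hc 4).const_mul a).prodMk
        ((hc 5).const_mul (a / X))))
  rw [h.fderiv]
  simp [scaling, coord_zero, coord_one, coord_two, coord_three, coord_four, coord_five]

theorem scaling_comp {T' X' U' a' τ' ξ' υ' : ℝ} (hX : X ≠ 0) (hX' : X' ≠ 0) (z : Ext) :
    scaling T' X' U' a' τ' ξ' υ' (scaling T X U a τ ξ υ z) =
      scaling (T' * T) (X' * X) (U' * U) (a' * a) (T' * τ + τ') (X' * ξ + ξ') (U' * υ + υ') z := by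
  simp only [scaling, Prod.mk.injEq]
  refine ⟨⟨?_, ?_, ?_⟩, ?_, ?_, ?_⟩ <;> field_simp <;> ring

theorem scaling_one (z : Ext) : scaling 1 1 1 1 0 0 0 z = z := by
  simp [scaling]

theorem scaling_inv_comp (hT : T ≠ 0) (hX : X ≠ 0) (hU : U ≠ 0) (ha : a ≠ 0) (z : Ext) :
    scaling T⁻¹ X⁻¹ U⁻¹ a⁻¹ (-(T⁻¹ * τ)) (-(X⁻¹ * ξ)) (-(U⁻¹ * υ))
      (scaling T X U a τ ξ υ z) = z := by
  rw [scaling_comp hX (inv_ne_zero hX)]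
  simp [hT, hX, hU, ha, scaling_one]

theorem scaling_comp_inv (hT : T ≠ 0) (hX : X ≠ 0) (hU : U ≠ 0) (ha : a ≠ 0) (z : Ext) :
    scaling T X U a τ ξ υ
      (scaling T⁻¹ X⁻¹ U⁻¹ a⁻¹ (-(T⁻¹ * τ)) (-(X⁻¹ * ξ)) (-(U⁻¹ * υ)) z) = z := by
  rw [scaling_comp (inv_ne_zero hX) hX]
  simp [hT, hX, hU, ha, scaling_one]

theorem bijective_scaling (hT : T ≠ 0) (hX : X ≠ 0) (hU : U ≠ 0) (ha : a ≠ 0) :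
    Function.Bijective (scaling T X U a τ ξ υ) :=
  Function.bijective_iff_has_inverse.mpr
    ⟨_, scaling_inv_comp hT hX hU ha, scaling_comp_inv hT hX hU ha⟩

/-- The partial derivatives of a smooth function. -/
theorem exists_partial_derivatives {v : ℝ × ℝ → ℝ} {s : ℝ × ℝ} (hv : ContDiffAt ℝ ∞ v s) :
    ∃ (a : ℝ) (b : ℝ → ℝ) (c : ℝ), HasDerivAt (fun t ↦ v (t, s.2)) a s.1 ∧
      (∀ᶠ x in 𝓝 s.2, HasDerivAt (fun y ↦ v (s.1, y)) (b x) x) ∧ HasDerivAt b c s.2 := by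
  -- A graph is trivially an implicit solution of `u - v (t, x) = 0`, so the derivatives come from
  -- `implicit_derivatives`.
  have hG : ContDiffAt ℝ ∞ (fun q : Base ↦ q.2.2 - v (q.1, q.2.1)) (s.1, s.2, v s) := by
    have h1 : ContDiffAt ℝ ∞ (fun q : Base ↦ (q.1, q.2.1)) (s.1, s.2, v s) := by fun_prop
    have h2 : ContDiffAt ℝ ∞ v ((fun q : Base ↦ (q.1, q.2.1)) (s.1, s.2, v s)) := hv
    exact ContDiffAt.sub (by fun_prop) (h2.comp (f := fun q : Base ↦ (q.1, q.2.1)) _ h1)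
  obtain ⟨a, b, c, h1, h2, h3, -⟩ := implicit_derivatives (v := v) hG rfl hv
    (Filter.Eventually.of_forall fun s ↦ sub_self _)
  exact ⟨a, b, c, h1, h2, h3⟩

/-- The transformed equation is `a U / X²` times the original one, after the chain rule for affine
substitutions. -/
theorem mapsEquationAt_scaling (hT : T ≠ 0) (hX : X ≠ 0) (hU : U ≠ 0) (ha : a ≠ 0)
    {θ : Equation} {q : Base} (hq : q ∈ θ.dom) :
    MapsEquationAt (scaling T X U a τ ξ υ) θ (θ.scale hT hX hU ha ξ υ) q := by
  have ex : ∀ x : ℝ, (X * x + ξ - ξ) / X = x := fun x ↦ by field_simp; ring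
  have eu : ∀ u : ℝ, (U * u + υ - υ) / U = u := fun u ↦ by field_simp; ring
  have hind : ∀ p : Base, induced (scaling T X U a τ ξ υ) θ p =
      (T * p.1 + τ, X * p.2.1 + ξ, U * p.2.2 + υ) := fun p ↦ rfl
  have hD : HasDerivAt θ.D (deriv θ.D q.2.2) q.2.2 :=
    ((Equation.contDiffAt_D hq).differentiableAt (by simp)).hasDerivAt
  refine ⟨?_, ?_, ?_, ?_⟩
  · have hfd : ∀ w, fderiv ℝ (induced (scaling T X U a τ ξ υ) θ) q w =
        (T * w.1, X * w.2.1, U * w.2.2) := by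
      intro w
      rw [fderiv_induced contDiff_scaling.contDiffAt hq, fderiv_scaling]
      simp [scaling, Equation.liftDeriv]
    constructor
    · intro w w' h
      rw [hfd, hfd] at h
      simp only [Prod.mk.injEq, mul_right_inj' hT, mul_right_inj' hX, mul_right_inj' hU] at h
      exact Prod.ext h.1 (Prod.ext h.2.1 h.2.2)
    · intro w
      refine ⟨(w.1 / T, w.2.1 / X, w.2.2 / U), ?_⟩
      rw [hfd]
      simp only [mul_div_cancel₀ _ hT, mul_div_cancel₀ _ hX, mul_div_cancel₀ _ hU]
  · rw [hind]
    constructor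
    · simpa only [Equation.scale, Set.mem_preimage, ex] using hq.1
    · simpa only [Equation.scale, Set.mem_preimage, eu] using hq.2
  · simp only [hind, Equation.lift, Equation.scale, ex, eu, scaling]
  · intro v v' hv0 hv hv' hvv
    obtain ⟨b₀, b, c, hb₀, hb, hc⟩ := exists_partial_derivatives hv
    simp only [hind] at hvv hv' ⊢
    -- The map of `(t, x)` is invertible and independent of `u`, so the graph condition determines
    -- `v'` near the image point.
    have hev : ∀ᶠ s' in 𝓝 (T * q.1 + τ, X * q.2.1 + ξ),
        v' s' = U * v ((s'.1 - τ) / T, (s'.2 - ξ) / X) + υ := by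
      have hcont : Filter.Tendsto (fun s' : ℝ × ℝ ↦ ((s'.1 - τ) / T, (s'.2 - ξ) / X))
          (𝓝 (T * q.1 + τ, X * q.2.1 + ξ)) (𝓝 (q.1, q.2.1)) := by
        have h1 : Continuous (fun s' : ℝ × ℝ ↦ ((s'.1 - τ) / T, (s'.2 - ξ) / X)) := by fun_prop
        have h2 := h1.tendsto (T * q.1 + τ, X * q.2.1 + ξ)
        simpa [hT, hX] using h2
      filter_upwards [hcont.eventually hvv] with s' hs'
      rw [← hs']
      congr 1
      ext <;> simp <;> field_simp <;> ring
    have hv'0 : v' (T * q.1 + τ, X * q.2.1 + ξ) = U * q.2.2 + υ := by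
      rw [hev.self_of_nhds]
      simp [hT, hX, hv0]
    have d1 : HasDerivAt (fun t ↦ v' (t, X * q.2.1 + ξ)) (U * (b₀ / T)) (T * q.1 + τ) := by
      have h1 := ((hasDerivAt_comp_affine hT hb₀ (d := τ) rfl).const_mul U).add_const υ
      refine h1.congr_of_eventuallyEq ?_
      have h2 : Filter.Tendsto (fun t : ℝ ↦ (t, X * q.2.1 + ξ)) (𝓝 (T * q.1 + τ))
          (𝓝 (T * q.1 + τ, X * q.2.1 + ξ)) := (Continuous.prodMk_left _).continuousAt
      filter_upwards [h2.eventually hev] with t ht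
      rw [ht, ex]
    have d2 : ∀ᶠ x in 𝓝 (X * q.2.1 + ξ), HasDerivAt (fun y ↦ v' (T * q.1 + τ, y))
        (U * (b ((x - ξ) / X) / X)) x := by
      have h2 : Filter.Tendsto (fun x : ℝ ↦ (T * q.1 + τ, x)) (𝓝 (X * q.2.1 + ξ))
          (𝓝 (T * q.1 + τ, X * q.2.1 + ξ)) := (Continuous.prodMk_right _).continuousAt
      have h3 : Filter.Tendsto (fun x : ℝ ↦ (x - ξ) / X) (𝓝 (X * q.2.1 + ξ)) (𝓝 q.2.1) := by
        have h4 : Continuous (fun x : ℝ ↦ (x - ξ) / X) := by fun_prop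
        have h5 := h4.tendsto (X * q.2.1 + ξ)
        rwa [ex] at h5
      filter_upwards [(h2.eventually hev).eventually_nhds, h3.eventually hb] with x hx hbx
      have h1 := ((hasDerivAt_comp_affine hX hbx (d := ξ) (y := x)
        (by field_simp; ring)).const_mul U).add_const υ
      refine h1.congr_of_eventuallyEq ?_
      filter_upwards [hx] with y hy
      rw [hy]
      simp [hT]
    have d3 : HasDerivAt (fun x ↦ U * (b ((x - ξ) / X) / X)) (U * (c / X / X)) (X * q.2.1 + ξ) :=
      ((hasDerivAt_comp_affine hX hc (d := ξ) rfl).div_const X).const_mul U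
    have hmem : v' (T * q.1 + τ, X * q.2.1 + ξ) ∈ (θ.scale hT hX hU ha ξ υ).J := by
      rw [hv'0]
      simpa only [Equation.scale, Set.mem_preimage, eu] using hq.2
    have hdD : deriv (θ.scale hT hX hU ha ξ υ).D (U * q.2.2 + υ) = a * (deriv θ.D q.2.2 / U) :=
      ((hasDerivAt_comp_affine hU hD (d := υ) rfl).const_mul a).deriv
    rw [Equation.holdsAt_iff θ (s := (q.1, q.2.1)) (by rw [hv0]; exact hq.2) hb₀ hb hc,
      Equation.holdsAt_iff _ (s := (T * q.1 + τ, X * q.2.1 + ξ)) hmem d1 d2 d3, hv'0, hv0, hdD]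
    simp only [Equation.scale, ex, eu]
    have hne : a * U / X ^ 2 ≠ 0 := by positivity
    rw [← mul_right_inj' hne]
    have e1 : a * U / X ^ 2 * (θ.f q.2.1 * b₀) = a * T / X ^ 2 * θ.f q.2.1 * (U * (b₀ / T)) := by
      field_simp
    have e2 : a * U / X ^ 2 * (θ.D q.2.2 * c + deriv θ.D q.2.2 * b q.2.1 ^ 2
        + θ.K q.2.2 * b q.2.1) = a * θ.D q.2.2 * (U * (c / X / X))
        + a * (deriv θ.D q.2.2 / U) * (U * (b q.2.1 / X)) ^ 2
        + a / X * θ.K q.2.2 * (U * (b q.2.1 / X)) := by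
      field_simp
    rw [e1, e2]

theorem isEquivalence_scaling (hT : T ≠ 0) (hX : X ≠ 0) (hU : U ≠ 0) (ha : a ≠ 0) (W : Set Ext) :
    IsEquivalence (scaling T X U a τ ξ υ) W where
  smooth := contDiff_scaling.contDiffOn
  injOn := (bijective_scaling hT hX hU ha).1.injOn
  bijective_fderiv z _ := by
    have : ⇑(fderiv ℝ (scaling T X U a τ ξ υ) z) = scaling T X U a 0 0 0 :=
      funext (fderiv_scaling z)
    rw [this]
    exact bijective_scaling hT hX hU ha
  maps_class θ p hp _ := by
    refine ⟨θ.scale hT hX hU ha ξ υ, ?_⟩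
    filter_upwards [θ.isOpen_dom.mem_nhds hp] with q hq
    exact mapsEquationAt_scaling hT hX hU ha hq

end scaling

/-! ### The generated group and the scalings -/

theorem exists_scaling_of_mem_generatedGroup {ψ : Equiv.Perm Ext} (hψ : ψ ∈ generatedGroup) :
    ∃ T X U a τ ξ υ : ℝ, T ≠ 0 ∧ X ≠ 0 ∧ U ≠ 0 ∧ a ≠ 0 ∧
      ∀ z, ψ z = scaling T X U a τ ξ υ z := by
  induction hψ using Subgroup.closure_induction with
  | mem ψ h =>
    have hne : (-1 : ℝ) ≠ 0 := by norm_num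
    have h1 := one_ne_zero (α := ℝ)
    rcases h with ⟨ε₁, ε₂, ε₃, ε₄, ε₅, ε₆, ε₇, rfl⟩ | rfl | rfl | rfl | rfl
    · refine ⟨Real.exp ε₄, Real.exp ε₅, Real.exp ε₆, Real.exp ε₇, ε₁, ε₂, ε₃,
        Real.exp_ne_zero _, Real.exp_ne_zero _, Real.exp_ne_zero _, Real.exp_ne_zero _, fun z ↦ ?_⟩
      have e1 : Real.exp (ε₄ - 2 * ε₅ + ε₇) = Real.exp ε₇ * Real.exp ε₄ / Real.exp ε₅ ^ 2 := by
        rw [← Real.exp_add, ← Real.exp_nat_mul, ← Real.exp_sub]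
        congr 1
        push_cast
        ring
      have e2 : Real.exp (-ε₅ + ε₇) = Real.exp ε₇ / Real.exp ε₅ := by
        rw [← Real.exp_sub]
        congr 1
        ring
      simp only [continuousTransformation, Equiv.coe_fn_mk, scaling, e1, e2]
      ext <;> simp only [] <;> ring
    · exact ⟨-1, 1, 1, -1, 0, 0, 0, hne, h1, h1, hne, fun z ↦ by simp [signTDK, scaling]⟩
    · exact ⟨1, -1, 1, 1, 0, 0, 0, h1, hne, h1, h1, fun z ↦ by simp [signXK, scaling]⟩
    · exact ⟨1, 1, -1, 1, 0, 0, 0, h1, h1, hne, h1, fun z ↦ by simp [signU, scaling]⟩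
    · exact ⟨1, 1, 1, -1, 0, 0, 0, h1, h1, h1, hne, fun z ↦ by simp [signFDK, scaling]⟩
  | one =>
    exact ⟨1, 1, 1, 1, 0, 0, 0, one_ne_zero, one_ne_zero, one_ne_zero, one_ne_zero,
      fun z ↦ (scaling_one z).symm⟩
  | mul ψ ψ' _ _ h h' =>
    obtain ⟨T, X, U, a, τ, ξ, υ, hT, hX, hU, ha, h⟩ := h
    obtain ⟨T', X', U', a', τ', ξ', υ', hT', hX', hU', ha', h'⟩ := h'
    refine ⟨T * T', X * X', U * U', a * a', T * τ' + τ, X * ξ' + ξ, U * υ' + υ,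
      mul_ne_zero hT hT', mul_ne_zero hX hX', mul_ne_zero hU hU', mul_ne_zero ha ha', fun z ↦ ?_⟩
    rw [Equiv.Perm.mul_apply, h', h, scaling_comp hX' hX]
  | inv ψ _ h =>
    obtain ⟨T, X, U, a, τ, ξ, υ, hT, hX, hU, ha, h⟩ := h
    refine ⟨T⁻¹, X⁻¹, U⁻¹, a⁻¹, -(T⁻¹ * τ), -(X⁻¹ * ξ), -(U⁻¹ * υ), inv_ne_zero hT,
      inv_ne_zero hX, inv_ne_zero hU, inv_ne_zero ha, fun z ↦ ?_⟩
    rw [Equiv.Perm.inv_eq_iff_eq, h]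
    exact (scaling_comp_inv hT hX hU ha z).symm

section generatedGroup

variable {T X U a : ℝ}

theorem exists_mem_generatedGroup_of_pos (hT : 0 < T) (hX : 0 < X) (hU : 0 < U) (ha : 0 < a)
    (τ ξ υ : ℝ) : ∃ ψ ∈ generatedGroup, ∀ z, ψ z = scaling T X U a τ ξ υ z := by
  refine ⟨continuousTransformation τ ξ υ (Real.log T) (Real.log X) (Real.log U) (Real.log a),
    Subgroup.subset_closure (Or.inl ⟨_, _, _, _, _, _, _, rfl⟩), fun z ↦ ?_⟩
  have e1 : Real.exp (Real.log T - 2 * Real.log X + Real.log a) = a * T / X ^ 2 := by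
    rw [Real.exp_add, Real.exp_sub, two_mul, Real.exp_add, Real.exp_log hT, Real.exp_log hX,
      Real.exp_log ha]
    ring
  have e2 : Real.exp (-Real.log X + Real.log a) = a / X := by
    rw [Real.exp_add, Real.exp_neg, Real.exp_log hX, Real.exp_log ha]
    ring
  simp only [continuousTransformation, Equiv.coe_fn_mk, scaling, e1, e2, Real.exp_log hT,
    Real.exp_log hX, Real.exp_log hU, Real.exp_log ha]
  ext <;> simp only [] <;> ring

theorem mul_mem_generatedGroup {σ ψ : Equiv.Perm Ext}
    (hσ : σ = signTDK ∨ σ = signXK ∨ σ = signU ∨ σ = signFDK) (hψ : ψ ∈ generatedGroup) :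
    σ * ψ ∈ generatedGroup :=
  mul_mem (Subgroup.subset_closure (Or.inr hσ)) hψ

/-- Every scaling belongs to the generated group. -/
theorem exists_mem_generatedGroup (hT : T ≠ 0) (hX : X ≠ 0) (hU : U ≠ 0) (ha : a ≠ 0)
    (τ ξ υ : ℝ) : ∃ ψ ∈ generatedGroup, ∀ z, ψ z = scaling T X U a τ ξ υ z := by
  -- The signs are normalised one factor at a time, `a` innermost: the involution for `t` also
  -- reverses `a`, so it must be peeled off while `a` may still have either sign.
  have step_a : ∀ {T X U a : ℝ}, 0 < T → 0 < X → 0 < U → a ≠ 0 → ∀ τ ξ υ : ℝ,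
      ∃ ψ ∈ generatedGroup, ∀ z, ψ z = scaling T X U a τ ξ υ z := by
    intro T X U a hT hX hU ha τ ξ υ
    rcases lt_or_gt_of_ne ha with h | h
    · obtain ⟨ψ, hψ, e⟩ := exists_mem_generatedGroup_of_pos hT hX hU (neg_pos.mpr h) τ ξ υ
      refine ⟨signFDK * ψ, mul_mem_generatedGroup (by simp) hψ, fun z ↦ ?_⟩
      rw [Equiv.Perm.mul_apply, e]
      simp [signFDK, scaling, neg_div]
    · exact exists_mem_generatedGroup_of_pos hT hX hU h τ ξ υ
  have step_U : ∀ {T X U a : ℝ}, 0 < T → 0 < X → U ≠ 0 → a ≠ 0 → ∀ τ ξ υ : ℝ,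
      ∃ ψ ∈ generatedGroup, ∀ z, ψ z = scaling T X U a τ ξ υ z := by
    intro T X U a hT hX hU ha τ ξ υ
    rcases lt_or_gt_of_ne hU with h | h
    · obtain ⟨ψ, hψ, e⟩ := step_a hT hX (neg_pos.mpr h) ha τ ξ (-υ)
      refine ⟨signU * ψ, mul_mem_generatedGroup (by simp) hψ, fun z ↦ ?_⟩
      rw [Equiv.Perm.mul_apply, e]
      simp [signU, scaling, add_comm]
    · exact step_a hT hX h ha τ ξ υ
  have step_X : ∀ {T X U a : ℝ}, 0 < T → X ≠ 0 → U ≠ 0 → a ≠ 0 → ∀ τ ξ υ : ℝ,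
      ∃ ψ ∈ generatedGroup, ∀ z, ψ z = scaling T X U a τ ξ υ z := by
    intro T X U a hT hX hU ha τ ξ υ
    rcases lt_or_gt_of_ne hX with h | h
    · obtain ⟨ψ, hψ, e⟩ := step_U hT (neg_pos.mpr h) hU ha τ (-ξ) υ
      refine ⟨signXK * ψ, mul_mem_generatedGroup (by simp) hψ, fun z ↦ ?_⟩
      rw [Equiv.Perm.mul_apply, e]
      simp [signXK, scaling, add_comm, div_neg]
    · exact step_U hT h hU ha τ ξ υ
  rcases lt_or_gt_of_ne hT with h | h
  · obtain ⟨ψ, hψ, e⟩ := step_X (neg_pos.mpr h) hX hU (neg_ne_zero.mpr ha) (-τ) ξ υ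
    refine ⟨signTDK * ψ, mul_mem_generatedGroup (by simp) hψ, fun z ↦ ?_⟩
    rw [Equiv.Perm.mul_apply, e]
    simp [signTDK, scaling, add_comm, neg_div]
  · exact step_X h hX hU ha τ ξ υ

end generatedGroup

/-- The equivalence transformations are the restrictions of the elements of the generated group. -/
theorem isEquivalence_iff {W : Set Ext} (hW : IsOpen W) (hc : IsConnected W) (hreg : W ⊆ regular)
    (φ : Ext → Ext) : IsEquivalence φ W ↔ ∃ ψ ∈ generatedGroup, Set.EqOn φ ψ W := by
  constructor
  · intro h
    obtain ⟨T, X, U, a, τ, ξ, υ, hT, hX, hU, ha, he⟩ := h.exists_scaling hW hc hreg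
    obtain ⟨ψ, hψ, e⟩ := exists_mem_generatedGroup hT hX hU ha τ ξ υ
    exact ⟨ψ, hψ, fun z hz ↦ (he hz).trans (e z).symm⟩
  · rintro ⟨ψ, hψ, he⟩
    obtain ⟨T, X, U, a, τ, ξ, υ, hT, hX, hU, ha, e⟩ := exists_scaling_of_mem_generatedGroup hψ
    exact (isEquivalence_scaling hT hX hU ha W).congr hW fun z hz ↦ (he hz).trans (e z)

/-! ### The Lie algebra -/

/-- A linear combination of the generators. -/
def field (c : Fin 7 → ℝ) (z : Ext) : Ext :=
  ((c 0 + c 3 * z.1.1, c 1 + c 4 * z.1.2.1, c 2 + c 5 * z.1.2.2),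
    ((c 6 + c 3 - 2 * c 4) * z.2.1, c 6 * z.2.2.1, (c 6 - c 4) * z.2.2.2))

theorem sum_generator (c : Fin 7 → ℝ) : ∑ i, c i • generator i = field c := by
  funext z
  simp only [Fin.sum_univ_seven, Pi.add_apply, Pi.smul_apply]
  simp only [generator, field, Matrix.cons_val]
  ext <;> simp <;> ring

theorem mem_span_generator {R : Ext → Ext} :
    R ∈ Submodule.span ℝ (Set.range generator) ↔ ∃ c, R = field c := by
  rw [Submodule.mem_span_range_iff_exists_fun]
  simp only [sum_generator, eq_comm]

theorem analyticAt_field (c : Fin 7 → ℝ) (z : Ext) : AnalyticAt ℝ (field c) z := by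
  have hc : ∀ i, AnalyticAt ℝ (fun y ↦ coord i y) z := fun i ↦ (coord i).analyticAt z
  have hk : ∀ r : ℝ, AnalyticAt ℝ (fun _ : Ext ↦ r) z := fun r ↦ analyticAt_const
  exact (((hk (c 0)).add ((hk (c 3)).mul (hc 0))).prod (((hk (c 1)).add ((hk (c 4)).mul (hc 1))).prod
    ((hk (c 2)).add ((hk (c 5)).mul (hc 2))))).prod
      (((hk (c 6 + c 3 - 2 * c 4)).mul (hc 3)).prod (((hk (c 6)).mul (hc 4)).prod
        ((hk (c 6 - c 4)).mul (hc 5))))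

/-- The velocity of a curve of scalings that starts at the identity. -/
theorem hasDerivAt_scaling {T X U a τ ξ υ : ℝ → ℝ} {c : Fin 7 → ℝ} {ε : ℝ} (hX : X ε ≠ 0)
    (dτ : HasDerivAt τ (c 0 + c 3 * τ ε) ε) (dξ : HasDerivAt ξ (c 1 + c 4 * ξ ε) ε)
    (dυ : HasDerivAt υ (c 2 + c 5 * υ ε) ε) (dT : HasDerivAt T (c 3 * T ε) ε)
    (dX : HasDerivAt X (c 4 * X ε) ε) (dU : HasDerivAt U (c 5 * U ε) ε)
    (da : HasDerivAt a (c 6 * a ε) ε) (z : Ext) :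
    HasDerivAt (fun s ↦ scaling (T s) (X s) (U s) (a s) (τ s) (ξ s) (υ s) z)
      (field c (scaling (T ε) (X ε) (U ε) (a ε) (τ ε) (ξ ε) (υ ε) z)) ε := by
  have h1 := (dT.mul_const z.1.1).add dτ
  have h2 := (dX.mul_const z.1.2.1).add dξ
  have h3 := (dU.mul_const z.1.2.2).add dυ
  have h4 := ((da.mul dT).div (dX.pow 2) (pow_ne_zero 2 hX)).mul_const z.2.1
  have h5 := da.mul_const z.2.2.1
  have h6 := (da.div dX hX).mul_const z.2.2.2
  refine HasDerivAt.congr_deriv ((h1.prodMk (h2.prodMk h3)).prodMk (h4.prodMk (h5.prodMk h6))) ?_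
  simp only [field, scaling, Prod.mk.injEq]
  refine ⟨⟨?_, ?_, ?_⟩, ?_, ?_, ?_⟩
  · ring
  · ring
  · ring
  · simp only [Pi.mul_apply, Pi.pow_apply]
    field_simp
    ring
  · ring
  · field_simp

/-- Solution of the linear differential equation `g' = d + c g`, `g 0 = 0`. -/
theorem exists_linear_flow (c d : ℝ) :
    ∃ g : ℝ → ℝ, g 0 = 0 ∧ ∀ ε, HasDerivAt g (d + c * g ε) ε := by
  by_cases hc : c = 0
  · refine ⟨fun ε ↦ d * ε, by simp, fun ε ↦ ?_⟩
    simpa [hc] using (hasDerivAt_id ε).const_mul d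
  · refine ⟨fun ε ↦ d / c * (Real.exp (c * ε) - 1), by simp, fun ε ↦ ?_⟩
    have h := ((((hasDerivAt_id ε).const_mul c).exp).sub_const 1).const_mul (d / c)
    refine HasDerivAt.congr_deriv h ?_
    simp
    field_simp
    ring

theorem hasDerivAt_exp_mul (c ε : ℝ) :
    HasDerivAt (fun s ↦ Real.exp (c * s)) (c * Real.exp (c * ε)) ε := by
  have h := ((hasDerivAt_id ε).const_mul c).exp
  refine HasDerivAt.congr_deriv h ?_
  simp
  ring

/-- The flow is explicit: exponential factors, with shifts solving scalar linear equations. Its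
joint continuity at `(0, z₀)` supplies a neighbourhood and a time for which orbits stay in `W`. -/
theorem isInfinitesimalEquivalence_of_eqOn {W : Set Ext} (hW : IsOpen W) {Q : Ext → Ext}
    {c : Fin 7 → ℝ} (hQ : Set.EqOn Q (field c) W) : IsInfinitesimalEquivalence Q W where
  smooth := by
    have h : ContDiff ℝ ∞ (field c) := by
      unfold field
      fun_prop
    exact h.contDiffOn.congr hQ
  exists_flow z₀ hz₀ := by
    obtain ⟨τ, τ0, dτ⟩ := exists_linear_flow (c 3) (c 0)
    obtain ⟨ξ, ξ0, dξ⟩ := exists_linear_flow (c 4) (c 1)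
    obtain ⟨υ, υ0, dυ⟩ := exists_linear_flow (c 5) (c 2)
    have cτ : Continuous τ := continuous_iff_continuousAt.mpr fun ε ↦ (dτ ε).continuousAt
    have cξ : Continuous ξ := continuous_iff_continuousAt.mpr fun ε ↦ (dξ ε).continuousAt
    have cυ : Continuous υ := continuous_iff_continuousAt.mpr fun ε ↦ (dυ ε).continuousAt
    set Φ : ℝ → Ext → Ext := fun ε ↦ scaling (Real.exp (c 3 * ε)) (Real.exp (c 4 * ε))
      (Real.exp (c 5 * ε)) (Real.exp (c 6 * ε)) (τ ε) (ξ ε) (υ ε) with hΦ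
    have hΦ0 : ∀ z, Φ 0 z = z := fun z ↦ by simp [hΦ, τ0, ξ0, υ0, scaling_one]
    have hcont : Continuous (fun y : ℝ × Ext ↦ Φ y.1 y.2) := by
      simp only [hΦ, scaling]
      have hne : ∀ y : ℝ × Ext, Real.exp (c 4 * y.1) ≠ 0 := fun y ↦ Real.exp_ne_zero _
      have hne2 : ∀ y : ℝ × Ext, Real.exp (c 4 * y.1) ^ 2 ≠ 0 := fun y ↦ pow_ne_zero 2 (hne y)
      fun_prop (disch := assumption)
    have hmem : (fun y : ℝ × Ext ↦ Φ y.1 y.2) ⁻¹' W ∈ 𝓝 ((0 : ℝ), z₀) := by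
      refine hcont.continuousAt.preimage_mem_nhds (hW.mem_nhds ?_)
      simpa only [hΦ0] using hz₀
    obtain ⟨u, v, hu, h0u, hv, hzv, huv⟩ := mem_nhds_prod_iff'.mp hmem
    obtain ⟨r, hr, hru⟩ := Metric.isOpen_iff.mp hu 0 h0u
    refine ⟨v ∩ W, hv.inter hW, ⟨hzv, hz₀⟩, Set.inter_subset_right, r, hr, Φ, fun z _ ↦ hΦ0 z,
      ?_, ?_⟩
    · intro z hz ε hε
      have hin : Φ ε z ∈ W := huv (Set.mk_mem_prod (hru (by simpa using hε)) hz.1)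
      refine ⟨hin, ?_⟩
      rw [hQ hin]
      exact hasDerivAt_scaling (X := fun s ↦ Real.exp (c 4 * s)) (Real.exp_ne_zero _) (dτ ε) (dξ ε) (dυ ε)
        (hasDerivAt_exp_mul _ _) (hasDerivAt_exp_mul _ _) (hasDerivAt_exp_mul _ _)
        (hasDerivAt_exp_mul _ _) z
    · intro ε _
      exact isEquivalence_scaling (Real.exp_ne_zero _) (Real.exp_ne_zero _) (Real.exp_ne_zero _)
        (Real.exp_ne_zero _) _

/-- An infinitesimal equivalence is locally a linear combination of the generators. -/
theorem IsInfinitesimalEquivalence.eventuallyEq_field {W : Set Ext} (hreg : W ⊆ regular)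
    {Q : Ext → Ext} (h : IsInfinitesimalEquivalence Q W) {z₀ : Ext} (hz₀ : z₀ ∈ W) :
    ∃ c, Q =ᶠ[𝓝 z₀] field c := by
  obtain ⟨V, hV, hzV, hVW, r, hr, Φ, hΦ0, hΦd, hΦe⟩ := h.exists_flow z₀ hz₀
  obtain ⟨ρ, hρ, hball⟩ := Metric.isOpen_iff.mp hV z₀ hzV
  have hconn : IsConnected (Metric.ball z₀ ρ) :=
    (convex_ball z₀ ρ).isConnected ⟨z₀, Metric.mem_ball_self hρ⟩
  have hex : ∀ ε : ℝ, ∃ T X U a τ ξ υ : ℝ, |ε| < r →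
      Set.EqOn (Φ ε) (scaling T X U a τ ξ υ) (Metric.ball z₀ ρ) := by
    intro ε
    by_cases hε : |ε| < r
    · obtain ⟨T, X, U, a, τ, ξ, υ, -, -, -, -, he⟩ := ((hΦe ε hε).mono hball).exists_scaling
        Metric.isOpen_ball hconn (hball.trans (hVW.trans hreg))
      exact ⟨T, X, U, a, τ, ξ, υ, fun _ ↦ he⟩
    · exact ⟨0, 0, 0, 0, 0, 0, 0, fun h ↦ absurd h hε⟩
  -- The parameters are chosen separately for each `ε`, with no regularity in `ε` known; outside the
  -- flow time they are dummies.
  choose T X U a τ ξ υ hs using hex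
  have hevr : ∀ᶠ ε : ℝ in 𝓝 0, |ε| < r := by
    have : Filter.Tendsto (fun ε : ℝ ↦ |ε|) (𝓝 0) (𝓝 |0|) := continuous_abs.tendsto 0
    rw [abs_zero] at this
    exact this.eventually (gt_mem_nhds hr)
  have hd : ∀ z ∈ Metric.ball z₀ ρ, HasDerivAt
      (fun ε ↦ scaling (T ε) (X ε) (U ε) (a ε) (τ ε) (ξ ε) (υ ε) z) (Q z) 0 := by
    intro z hz
    have h1 := (hΦd z (hball hz) 0 (by simpa using hr)).2
    rw [hΦ0 z (hball hz)] at h1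
    exact h1.congr_of_eventuallyEq (hevr.mono fun ε hε ↦ (hs ε hε hz).symm)
  have h0 : ∀ z ∈ Metric.ball z₀ ρ,
      scaling (T 0) (X 0) (U 0) (a 0) (τ 0) (ξ 0) (υ 0) z = z := fun z hz ↦
    (hs 0 (by simpa using hr) hz).symm.trans (hΦ0 z (hball hz))
  have hz0 : z₀ ∈ Metric.ball z₀ ρ := Metric.mem_ball_self hρ
  -- A second point differing from `z₀` in `t`, `x` and `u` at once: the two images determine the
  -- slope and shift of each affine map, so these inherit differentiability at `0` from the flow.
  obtain ⟨κ, hκ, hz1⟩ : ∃ κ : ℝ, κ ≠ 0 ∧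
      z₀ + ((κ, κ, κ), (0, 0, 0)) ∈ Metric.ball z₀ ρ := by
    refine ⟨ρ / 2, by positivity, ?_⟩
    have : |ρ| / 2 < ρ := by rw [abs_of_pos hρ]; linarith
    simp [Prod.norm_def, hρ, this]
  set z₁ : Ext := z₀ + ((κ, κ, κ), (0, 0, 0)) with hz₁
  have hDne := (hreg (hVW (hball hz0))).2
  have e0 := h0 z₀ hz0
  have e1 := h0 z₁ hz1
  simp only [scaling, Prod.ext_iff, hz₁, Prod.fst_add, Prod.snd_add] at e0 e1
  obtain ⟨⟨t0, x0, u0⟩, -, D0, -⟩ := e0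
  obtain ⟨⟨t1, x1, u1⟩, -⟩ := e1
  have T0 : T 0 = 1 := mul_right_cancel₀ hκ (by linarith)
  have X0 : X 0 = 1 := mul_right_cancel₀ hκ (by linarith)
  have U0 : U 0 = 1 := mul_right_cancel₀ hκ (by linarith)
  have a0 : a 0 = 1 := mul_right_cancel₀ hDne (by linarith)
  have τ0 : τ 0 = 0 := by rw [T0] at t0; linarith
  have ξ0 : ξ 0 = 0 := by rw [X0] at x0; linarith
  have υ0 : υ 0 = 0 := by rw [U0] at u0; linarith
  have hdi : ∀ (i : Fin 6), ∀ z ∈ Metric.ball z₀ ρ, HasDerivAt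
      (fun ε ↦ coord i (scaling (T ε) (X ε) (U ε) (a ε) (τ ε) (ξ ε) (υ ε) z)) (coord i (Q z)) 0 :=
    fun i z hz ↦ (coord i).hasFDerivAt.comp_hasDerivAt 0 (hd z hz)
  have slope : ∀ {g s : ℝ → ℝ} {y p q : ℝ}, HasDerivAt (fun ε ↦ g ε * y + s ε) p 0 →
      HasDerivAt (fun ε ↦ g ε * (y + κ) + s ε) q 0 →
      HasDerivAt g ((q - p) / κ) 0 ∧ HasDerivAt s (p - (q - p) / κ * y) 0 := by
    intro g s y p q h1 h2
    have h3 : HasDerivAt g ((q - p) / κ) 0 := by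
      refine ((h2.sub h1).div_const κ).congr_of_eventuallyEq (Filter.Eventually.of_forall fun ε ↦ ?_)
      simp only [Pi.sub_apply]
      field_simp
      ring
    refine ⟨h3, (h1.sub (h3.mul_const y)).congr_of_eventuallyEq
      (Filter.Eventually.of_forall fun ε ↦ ?_)⟩
    simp
  obtain ⟨dT, dτ⟩ := slope (hdi 0 z₀ hz0) (hdi 0 z₁ hz1)
  obtain ⟨dX, dξ⟩ := slope (hdi 1 z₀ hz0) (hdi 1 z₁ hz1)
  obtain ⟨dU, dυ⟩ := slope (hdi 2 z₀ hz0) (hdi 2 z₁ hz1)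
  have da : HasDerivAt a ((Q z₀).2.2.1 / z₀.2.2.1) 0 := by
    refine ((hdi 4 z₀ hz0).div_const z₀.2.2.1).congr_of_eventuallyEq
      (Filter.Eventually.of_forall fun ε ↦ ?_)
    simp only [coord_four, scaling]
    field_simp
  obtain ⟨c, hc⟩ : ∃ c : Fin 7 → ℝ, HasDerivAt τ (c 0) 0 ∧ HasDerivAt ξ (c 1) 0 ∧
      HasDerivAt υ (c 2) 0 ∧ HasDerivAt T (c 3) 0 ∧ HasDerivAt X (c 4) 0 ∧
      HasDerivAt U (c 5) 0 ∧ HasDerivAt a (c 6) 0 :=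
    ⟨![_, _, _, _, _, _, _], dτ, dξ, dυ, dT, dX, dU, da⟩
  obtain ⟨c0, c1, c2, c3, c4, c5, c6⟩ := hc
  refine ⟨c, ?_⟩
  filter_upwards [Metric.ball_mem_nhds z₀ hρ] with z hz
  have key := hasDerivAt_scaling (T := T) (X := X) (U := U) (a := a) (τ := τ) (ξ := ξ)
    (υ := υ) (c := c) (ε := 0) (by rw [X0]; exact one_ne_zero)
    (by simpa [τ0] using c0) (by simpa [ξ0] using c1) (by simpa [υ0] using c2)
    (by simpa [T0] using c3) (by simpa [X0] using c4) (by simpa [U0] using c5)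
    (by simpa [a0] using c6) z
  rw [h0 z hz] at key
  exact (hd z hz).unique key

/-- The infinitesimal equivalences are the linear combinations of the generators. -/
theorem isInfinitesimalEquivalence_iff {W : Set Ext} (hW : IsOpen W) (hc : IsConnected W)
    (hreg : W ⊆ regular) (Q : Ext → Ext) :
    IsInfinitesimalEquivalence Q W ↔
      ∃ R ∈ Submodule.span ℝ (Set.range generator), Set.EqOn Q R W := by
  constructor
  · intro h
    obtain ⟨z₀, hz₀⟩ := hc.nonempty
    obtain ⟨c, hQ⟩ := h.eventuallyEq_field hreg hz₀
    refine ⟨field c, mem_span_generator.mpr ⟨c, rfl⟩, ?_⟩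
    -- The local coefficients might depend on the point; since the local combinations are analytic,
    -- the identity theorem on the connected set `W` makes them agree.
    have hQa : AnalyticOnNhd ℝ Q W := by
      intro z hz
      obtain ⟨c', hc'⟩ := h.eventuallyEq_field hreg hz
      exact (analyticAt_field c' z).congr hc'.symm
    exact hQa.eqOn_of_preconnected_of_eventuallyEq (fun z _ ↦ analyticAt_field c z)
      hc.isPreconnected hz₀ hQ
  · rintro ⟨R, hR, hQ⟩
    obtain ⟨c, rfl⟩ := mem_span_generator.mp hR
    exact isInfinitesimalEquivalence_of_eqOn hW hQ

end DiffConv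

theorem theorem2 (W : Set DiffConv.Ext) (hW_open : IsOpen W) (hW_conn : IsConnected W)
    (hW_reg : W ⊆ DiffConv.regular) :
    (∀ Q : DiffConv.Ext → DiffConv.Ext,
      DiffConv.IsInfinitesimalEquivalence Q W ↔
        ∃ R ∈ Submodule.span ℝ (Set.range DiffConv.generator), Set.EqOn Q R W) ∧
    (∀ φ : DiffConv.Ext → DiffConv.Ext,
      DiffConv.IsEquivalence φ W ↔
        ∃ ψ ∈ DiffConv.generatedGroup, Set.EqOn φ ψ W) :=
  ⟨DiffConv.isInfinitesimalEquivalence_iff hW_open hW_conn hW_reg,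
    DiffConv.isEquivalence_iff hW_open hW_conn hW_reg⟩
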